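/- **Corollary (Structure).** Let $f$ be a function of a complex variable $t$ that is analytic for $\Re(t)>0$ and at $t=0$, of at most polynomial growth as $t\to+\infty$, and such that $f(t)>0$ for all real $t\ge 0$ (for example $f(t)=t^M\prod_{j=1}^M(1-e^{-a_jt})^{-1}$ with $a_j>0$). Let $(b_k)_{k\ge 0}$ be positive real numbers and let $M\le N$ be non-negative integers. For $\Re(w)>0$ let $\zeta_M(s,w)$ be the analytic continuation in $s$ to $\mathbb{C}\setminus\{1,\dots,M\}$ of $$\zeta_M(s,w)=\frac1{\Gamma(s)}\int_0^\infty t^{s-1}e^{-wt}f(t)\,\frac{dt}{t^M},\qquad \Re(s)>M,$$ and put $L_M(w)=\partial_s\zeta_M(s,w)|_{s=0}$. For a function $g$ put $$(\mathcal S_Ng)(q\,|\,b)=\sum_{p=0}^N(-1)^p\sum_{1\le k_1<\cdots<k_p\le N}g(q+b_0+b_{k_1}+\cdots+b_{k_p}),$$ and for $\Re(q)>-b_0$ let $$\eta_{M,N}(q\,|\,b)=\exp\bigl((\mathcal S_NL_M)(q\,|\,b)-(\mathcal S_NL_M)(0\,|\,b)\bigr).$$ Then there is exactly one probability distribution $\beta_{M,N}(b)$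 on $(0,1]$ such that $\mathbf E[\beta_{M,N}(b)^q]=\eta_{M,N}(q\,|\,b)$ (with the expectation absolutely convergent) for all $q\in\mathbb C$ with $\Re(q)>-b_0$, and it has the following structure. 1. If $M=N$, then the distribution of $\log\beta_{M,N}(b)$ is absolutely continuous with respect to Lebesgue measure on $\mathbb R$. 2. If $M<N$, then the measure $$\Lambda(dt)=e^{-b_0t}\prod_{j=1}^N(1-e^{-b_jt})\,\frac{f(t)}{t^{M+1}}\,dt\quad\text{on }(0,\infty)$$ is finite, and $-\log\beta_{M,N}(b)$ is compound Poisson with Lévy measure $\Lambda$: there are $r>0$ and a probability measure $\nu$ on $(0,\infty)$ with $\Lambda=r\,\nu$ such that $-\log\beta_{M,N}(b)$ has the law $\sum_{n\ge0}e^{-r}\frac{r^n}{n!}\,\nu^{*n}$ of a sum of a Poisson($r$) number of independent random variables with law $\nu$. Moreover $$\mathbf P[\beta_{M,N}(b)=1]=\exp\Bigl(-\int_0^\infty e^{-b_0t}\prod_{j=1}^N(1-e^{-b_jt})\,\frac{f(t)}{t^{M+1}}\,dt\Bigr).$$ -/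

import Mathlib

open MeasureTheory

noncomputable section

namespace BarnesBeta

/-- The Ruijsenaars class: `f` is analytic on the open right half-plane and at `0`, and grows at
worst polynomially at infinity. Only the growth along the positive half-line is required. -/
structure RuijsenaarsClass (f : ℂ → ℂ) : Prop where
  differentiableOn : DifferentiableOn ℂ f {t : ℂ | 0 < t.re}
  analyticAt_zero : AnalyticAt ℂ f 0
  growth : ∃ (C : ℝ) (n : ℕ), ∀ t : ℝ, 1 ≤ t → ‖f t‖ ≤ C * t ^ n

/-- `f` takes (real) positive values on `[0, ∞)`. -/
def PositiveOnHalfLine (f : ℂ → ℂ) : Prop :=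
  ∀ t : ℝ, 0 ≤ t → (f t).im = 0 ∧ 0 < (f t).re

/-- The integral `Γ(s)⁻¹ ∫₀^∞ t^(s-1) e^(-wt) f(t) t^(-M) dt`, which defines the generalized zeta
function for `Re s > M` and `Re w > 0`. -/
def zetaIntegral (f : ℂ → ℂ) (M : ℕ) (s w : ℂ) : ℂ :=
  (Complex.Gamma s)⁻¹ *
    ∫ t in Set.Ioi (0 : ℝ), (t : ℂ) ^ (s - 1) * Complex.exp (-w * t) * f t / (t : ℂ) ^ M

/-- `Z` is a holomorphic function of `s ∈ ℂ ∖ {1, …, M}` that agrees with the zeta integral for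
`Re s > M`. As `ℂ ∖ {1, …, M}` is connected, its values there are unique. -/
def IsZetaContinuation (f : ℂ → ℂ) (M : ℕ) (w : ℂ) (Z : ℂ → ℂ) : Prop :=
  DifferentiableOn ℂ Z {s : ℂ | ∀ k ∈ Finset.Icc 1 M, s ≠ (k : ℂ)} ∧
    ∀ s : ℂ, (M : ℝ) < s.re → Z s = zetaIntegral f M s w

open Classical in
/-- The generalized zeta function `ζ_M(s, w)`, for `Re w > 0`, continued to
`s ∈ ℂ ∖ {1, …, M}`. -/
def zeta (f : ℂ → ℂ) (M : ℕ) (s w : ℂ) : ℂ :=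
  if h : ∃ Z : ℂ → ℂ, IsZetaContinuation f M w Z then h.choose s else 0

/-- The generalized log-gamma function `L_M(w) = ∂_s ζ_M(s, w)` at `s = 0`, for `Re w > 0`. -/
def logGamma (f : ℂ → ℂ) (M : ℕ) (w : ℂ) : ℂ :=
  deriv (fun s : ℂ => zeta f M s w) 0

/-- The operator `𝒮_N`:
`(𝒮_N g)(q | b) = ∑_{p=0}^N (-1)^p ∑_{1 ≤ k₁ < ⋯ < k_p ≤ N} g (q + b₀ + b_{k₁} + ⋯ + b_{k_p})`. -/
def altSum (N : ℕ) (b : ℕ → ℝ) (g : ℂ → ℂ) (q : ℂ) : ℂ :=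
  ∑ p ∈ Finset.range (N + 1), (-1 : ℂ) ^ p *
    ∑ K ∈ Finset.powersetCard p (Finset.Icc 1 N), g (q + b 0 + ∑ k ∈ K, (b k : ℂ))

/-- `η_{M,N}(q | b) = exp ((𝒮_N L_M)(q | b) - (𝒮_N L_M)(0 | b))`, for `Re q > -b₀`. -/
def eta (f : ℂ → ℂ) (M N : ℕ) (b : ℕ → ℝ) (q : ℂ) : ℂ :=
  Complex.exp (altSum N b (logGamma f M) q - altSum N b (logGamma f M) 0)

/-- `μ` is a probability distribution on `(0, 1]` whose Mellin transform `∫ x^q dμ(x)` is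
`η_{M,N}(q | b)` for `Re q > -b₀`. -/
structure IsBarnesBeta (f : ℂ → ℂ) (M N : ℕ) (b : ℕ → ℝ) (μ : Measure ℝ) : Prop where
  isProbabilityMeasure : IsProbabilityMeasure μ
  support : μ (Set.Ioc (0 : ℝ) 1)ᶜ = 0
  integrable : ∀ q : ℂ, -b 0 < q.re → Integrable (fun x : ℝ => (x : ℂ) ^ q) μ
  mellin : ∀ q : ℂ, -b 0 < q.re → ∫ x : ℝ, (x : ℂ) ^ q ∂μ = eta f M N b q

open Classical in
/-- The Barnes beta distribution `β_{M,N}(b)`: the probability distribution on `(0, 1]` with Mellin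
transform `η_{M,N}(· | b)`. -/
def barnesBeta (f : ℂ → ℂ) (M N : ℕ) (b : ℕ → ℝ) : Measure ℝ :=
  if h : ∃ μ : Measure ℝ, IsBarnesBeta f M N b μ then h.choose else 0

/-- The `n`-fold convolution `ν ∗ ⋯ ∗ ν`, which is `δ₀` for `n = 0`. -/
def convPow (ν : Measure ℝ) : ℕ → Measure ℝ
  | 0 => Measure.dirac 0
  | n + 1 => (convPow ν n).conv ν

/-- The compound Poisson law with rate `r` and jump law `ν`, that is, the law of
`Y₁ + ⋯ + Y_K`, where `K` is Poisson with mean `r` and independent of the independent random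
variables `Y₁, Y₂, …` with law `ν`: the mixture `∑ₙ e^(-r) rⁿ / n! • ν^{∗n}`. -/
def compoundPoisson (r : ℝ) (ν : Measure ℝ) : Measure ℝ :=
  Measure.sum fun n : ℕ => ENNReal.ofReal (Real.exp (-r) * r ^ n / n.factorial) • convPow ν n

/-- `μ` is compound Poisson on `[0, ∞)` with Lévy measure `Λ`: for some rate `r > 0` and some jump
law `ν`, a probability measure on `(0, ∞)`, `μ` is the compound Poisson law with rate `r` and jump
law `ν`, and `Λ = r ν`. -/
def IsCompoundPoisson (μ Λ : Measure ℝ) : Prop :=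
  ∃ (r : ℝ) (ν : Measure ℝ), 0 < r ∧ IsProbabilityMeasure ν ∧ ν (Set.Iic 0) = 0 ∧
    μ = compoundPoisson r ν ∧ Λ = ENNReal.ofReal r • ν

/-- The Lévy density `e^(-b₀ t) ∏_{j=1}^N (1 - e^(-b_j t)) f(t) / t^(M+1)`, for `t > 0`. -/
def levyDensity (f : ℂ → ℂ) (M N : ℕ) (b : ℕ → ℝ) (t : ℝ) : ℝ :=
  Real.exp (-b 0 * t) * (∏ j ∈ Finset.Icc 1 N, (1 - Real.exp (-b j * t))) * (f t).re / t ^ (M + 1)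

/-- The Lévy measure on `(0, ∞)` with the density `levyDensity f M N b`. -/
def levyMeasure (f : ℂ → ℂ) (M N : ℕ) (b : ℕ → ℝ) : Measure ℝ :=
  (volume.restrict (Set.Ioi (0 : ℝ))).withDensity
    fun t => ENNReal.ofReal (levyDensity f M N b t)

end BarnesBeta

end

/-! ### Continuation of a Mellin transform by subtracting Taylor terms. -/

noncomputable section
open Set Filter Asymptotics Topology Complex

namespace BarnesBeta

/-! The signed sum over subsets in `altSum`, applied to `w ↦ e^(-wt)`, factors as `e^(-qt)` times
the product `levyExp`, which vanishes to order `N` at `t = 0`. Subtracting the value at `q = 0`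
turns `e^(-qt)` into `e^(-qt) - 1` and gains one more order. For `M ≤ N` the resulting combination
of zeta integrals therefore converges absolutely at `s = 0`. Since `1/Γ` has a zero of slope `1`
there, the `s`-derivative is the integral itself (`sum_logGamma_eq_mellin`). Hence `eta_eq`: `log
η(q)` can be taken to be `∫ (e^(-qt) - 1) Λ(dt)`, a Lévy–Khintchine exponent with no drift and no
Gaussian part.

A probability measure with this Laplace transform is unique, by characteristic functions, and exists
as the law of a series of independent compound Poisson variables, one for each slice of `Λ` away
from `0` (`IsLevy.exists_hasLevyMeasure`). The map `y ↦ e^(-y)` carries it to `(0, 1]`.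

The dichotomy is the total mass of `Λ`. If `M < N` it is finite, so the law is compound Poisson,
with an atom of mass `e^(-Λ(0,∞))` at `0`. If `M = N` the density behaves like `c/t` at `0` and the
mass is infinite. Splitting off the jumps larger than `ε` bounds the probability of any
Lebesgue-null set by `e^(-Λ(ε,∞))`, which tends to `0` with `ε`
(`HasLevyMeasure.absolutelyContinuous`). -/

/-- The remainder of `g` after subtracting its first `K` Taylor terms on `(0, 1]`. -/
def taylorRem (g : ℝ → ℂ) (a : ℕ → ℂ) (K : ℕ) (t : ℝ) : ℂ :=
  g t - ∑ n ∈ Finset.range K, a n • (Ioc (0 : ℝ) 1).indicator (fun t : ℝ => (t : ℂ) ^ (n : ℂ)) t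

/-- The function `1 / (Γ(s) (s - M + n))`, with removable singularities removed. -/
def gammaTerm (M n : ℕ) (s : ℂ) : ℂ :=
  if n < M then (Gamma s)⁻¹ / (s - M + n) else dslope (fun s => (Gamma s)⁻¹) ((M : ℂ) - n) s

/-- For `n ≥ M` the point `M - n` is a zero of `1/Γ`, so the divided difference based there is the
plain quotient. -/
theorem gammaTerm_eq {M n : ℕ} {s : ℂ} (hs : s ≠ M - n) :
    gammaTerm M n s = (Gamma s)⁻¹ / (s - M + n) := by
  unfold gammaTerm
  split_ifs with h
  · rfl
  · rw [dslope_of_ne _ hs, slope_def_field]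
    -- `Gamma` has the default value `0` at its poles, so its inverse is there the true value of the
    -- entire function `1/Γ`.
    have : Gamma ((M : ℂ) - n) = 0 := by
      obtain ⟨k, rfl⟩ := Nat.exists_eq_add_of_le (not_lt.mp h)
      rw [← Gamma_neg_nat_eq_zero k]
      congr 1
      push_cast
      ring
    rw [this]
    simp only [inv_zero, sub_zero]
    congr 1
    ring

theorem differentiableAt_gammaTerm {M : ℕ} (n : ℕ) {s : ℂ}
    (hs : ∀ k ∈ Finset.Icc 1 M, s ≠ (k : ℂ)) : DifferentiableAt ℂ (gammaTerm M n) s := by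
  unfold gammaTerm
  split_ifs with h
  · refine (differentiable_one_div_Gamma s).div (by fun_prop) fun h0 => ?_
    refine hs (M - n) (by simp; omega) ?_
    push_cast [h.le]
    linear_combination h0
  · have h1 : DifferentiableOn ℂ (dslope (fun s => (Gamma s)⁻¹) ((M : ℂ) - n)) univ :=
      (differentiableOn_dslope univ_mem).2 differentiable_one_div_Gamma.differentiableOn
    exact (h1 s (mem_univ s)).differentiableAt univ_mem

/-- The hypotheses on `g` under which its Mellin transform is continued: local integrability,
an asymptotic power series at `0`, exponential decay at infinity. -/
structure HasTaylorDecay (g : ℝ → ℂ) (a : ℕ → ℂ) : Prop where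
  locallyIntegrableOn : LocallyIntegrableOn g (Ioi 0)
  decay : ∃ c > 0, g =O[atTop] fun t => Real.exp (-c * t)
  taylor : ∀ K : ℕ, (fun t : ℝ => g t - ∑ n ∈ Finset.range K, a n * (t : ℂ) ^ n)
    =O[𝓝[>] 0] fun t : ℝ => t ^ (-(-(K : ℝ)))

namespace HasTaylorDecay

variable {g : ℝ → ℂ} {a : ℕ → ℂ}

/-- The Taylor terms are cut off at `t = 1`, so they do not spoil the decay of `g`. -/
theorem taylorRem_bigO_top (hg : HasTaylorDecay g a) (K : ℕ) :
    ∃ c > 0, taylorRem g a K =O[atTop] fun t => Real.exp (-c * t) := by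
  obtain ⟨c, hc, h⟩ := hg.decay
  refine ⟨c, hc, h.congr' ?_ EventuallyEq.rfl⟩
  filter_upwards [eventually_gt_atTop 1] with t ht
  have : t ∉ Ioc (0 : ℝ) 1 := fun h => absurd h.2 (not_le.2 ht)
  simp [taylorRem, this]

theorem taylorRem_bigO_zero (hg : HasTaylorDecay g a) (K : ℕ) :
    taylorRem g a K =O[𝓝[>] 0] fun t : ℝ => t ^ (-(-(K : ℝ))) := by
  refine (hg.taylor K).congr' ?_ EventuallyEq.rfl
  filter_upwards [Ioc_mem_nhdsGT (zero_lt_one' ℝ)] with t ht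
  simp [taylorRem, ht]

theorem taylorRem_locallyIntegrableOn (hg : HasTaylorDecay g a) (K : ℕ) :
    LocallyIntegrableOn (taylorRem g a K) (Ioi 0) := by
  unfold taylorRem
  refine hg.locallyIntegrableOn.sub ?_
  refine LocallyIntegrable.locallyIntegrableOn ?_ _
  refine Integrable.locallyIntegrable ?_
  refine integrable_finsetSum _ fun n _ => Integrable.smul (a n) ?_
  rw [integrable_indicator_iff measurableSet_Ioc]
  simp only [cpow_natCast]
  exact (ContinuousOn.integrableOn_Icc (by fun_prop)).mono_set Ioc_subset_Icc_self

theorem mellinConvergent_taylorRem (hg : HasTaylorDecay g a) (K : ℕ) {s : ℂ}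
    (hs : -(K : ℝ) < s.re) : MellinConvergent (taylorRem g a K) s := by
  obtain ⟨c, hc, h⟩ := hg.taylorRem_bigO_top K
  exact mellinConvergent_of_isBigO_rpow_exp hc (hg.taylorRem_locallyIntegrableOn K) h
    (hg.taylorRem_bigO_zero K) hs

theorem differentiableAt_mellin_taylorRem (hg : HasTaylorDecay g a) (K : ℕ) {s : ℂ}
    (hs : -(K : ℝ) < s.re) : DifferentiableAt ℂ (mellin (taylorRem g a K)) s := by
  obtain ⟨c, hc, h⟩ := hg.taylorRem_bigO_top K
  exact mellin_differentiableAt_of_isBigO_rpow_exp hc (hg.taylorRem_locallyIntegrableOn K) h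
    (hg.taylorRem_bigO_zero K) hs

/-- The Mellin transform of `t^K` cut off to `(0, 1]` is `1/(s + K)`; removing one more Taylor term
trades it for this explicit pole. -/
theorem mellin_taylorRem_succ (hg : HasTaylorDecay g a) (K : ℕ) {s : ℂ}
    (hs : -(K : ℝ) < s.re) :
    mellin (taylorRem g a K) s = mellin (taylorRem g a (K + 1)) s + a K / (s + K) := by
  have h1 := hasMellin_cpow_Ioc (K : ℂ) (s := s) (by simpa using by linarith)
  have h2 := hasMellin_const_smul h1.1 (a K)
  have h3 := hasMellin_add (hg.mellinConvergent_taylorRem (K + 1) (s := s)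
    (by push_cast; linarith)) h2.1
  rw [h2.2, h1.2] at h3
  convert h3.2 using 2
  · ext t
    simp only [taylorRem, Finset.sum_range_succ]
    ring
  · rw [smul_eq_mul]
    ring

/-- The partial continuation of the zeta integral to `Re s > M - K`. -/
def partialCont (g : ℝ → ℂ) (a : ℕ → ℂ) (M K : ℕ) (s : ℂ) : ℂ :=
  (Gamma s)⁻¹ * mellin (taylorRem g a K) (s - M) +
    ∑ n ∈ Finset.range K, a n * gammaTerm M n s

theorem partialCont_succ (hg : HasTaylorDecay g a) {M K : ℕ} {s : ℂ}
    (hs : (M : ℝ) - K < s.re) : partialCont g a M K s = partialCont g a M (K + 1) s := by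
  have hne : s ≠ M - K := by
    rintro rfl
    simp at hs
  rw [partialCont, partialCont, Finset.sum_range_succ, gammaTerm_eq hne,
    hg.mellin_taylorRem_succ K (by simp; linarith)]
  ring

theorem partialCont_eq (hg : HasTaylorDecay g a) {M K L : ℕ} {s : ℂ} (hKL : K ≤ L)
    (hs : (M : ℝ) - K < s.re) : partialCont g a M K s = partialCont g a M L s := by
  induction L, hKL using Nat.le_induction with
  | base => rfl
  | succ L h ih =>
    rw [ih, hg.partialCont_succ]
    have : (K : ℝ) ≤ L := by exact_mod_cast h
    linarith

theorem differentiableAt_partialCont (hg : HasTaylorDecay g a) {M K : ℕ} {s : ℂ}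
    (hs : (M : ℝ) - K < s.re) (hsM : ∀ k ∈ Finset.Icc 1 M, s ≠ (k : ℂ)) :
    DifferentiableAt ℂ (partialCont g a M K) s := by
  unfold partialCont
  have h1 : DifferentiableAt ℂ (mellin (taylorRem g a K)) (s - M) :=
    hg.differentiableAt_mellin_taylorRem K (by simp; linarith)
  have h2 : DifferentiableAt ℂ (fun s : ℂ => mellin (taylorRem g a K) (s - M)) s :=
    DifferentiableAt.comp (g := mellin (taylorRem g a K)) s h1 (by fun_prop)
  refine ((differentiable_one_div_Gamma s).mul h2).add ?_
  exact DifferentiableAt.fun_sum fun n _ => (differentiableAt_gammaTerm n hsM).const_mul _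

/-- The partial continuations agree wherever two of them are valid, so `K` may depend on `s`; near
any point it can be replaced by a fixed `K`, which gives holomorphy. -/
theorem exists_continuation (hg : HasTaylorDecay g a) (M : ℕ) :
    ∃ Z : ℂ → ℂ, DifferentiableOn ℂ Z {s : ℂ | ∀ k ∈ Finset.Icc 1 M, s ≠ (k : ℂ)} ∧
      ∀ s : ℂ, (M : ℝ) < s.re → Z s = (Gamma s)⁻¹ * mellin g (s - M) := by
  have key : ∀ (s : ℂ) (K : ℕ), (M : ℝ) - K < s.re →
      partialCont g a M (⌈(M : ℝ) - s.re⌉₊ + 1) s = partialCont g a M K s := by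
    intro s K hK
    have h1 : (M : ℝ) - (⌈(M : ℝ) - s.re⌉₊ + 1 : ℕ) < s.re := by
      have := Nat.le_ceil ((M : ℝ) - s.re)
      push_cast
      linarith
    rcases le_total (⌈(M : ℝ) - s.re⌉₊ + 1) K with h | h
    · exact hg.partialCont_eq h h1
    · exact (hg.partialCont_eq h hK).symm
  refine ⟨fun s => partialCont g a M (⌈(M : ℝ) - s.re⌉₊ + 1) s, fun s hs => ?_, fun s hs => ?_⟩
  · obtain ⟨K, hK⟩ := exists_nat_gt ((M : ℝ) - s.re)
    have hK' : (M : ℝ) - K < s.re := by linarith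
    have hev : ∀ᶠ z : ℂ in 𝓝 s, (M : ℝ) - K < z.re :=
      (isOpen_lt continuous_const continuous_re).mem_nhds hK'
    exact ((hg.differentiableAt_partialCont hK' hs).congr_of_eventuallyEq
      (hev.mono fun z hz => key z K hz)).differentiableWithinAt
  · refine (key s 0 (by simpa using hs)).trans ?_
    have : taylorRem g a 0 = g := by ext t; simp [taylorRem]
    simp [partialCont, this]

end HasTaylorDecay

end BarnesBeta
end

/-! ### The zeta function, and linear combinations of `L_M` as integrals. -/

noncomputable section
open Set Filter Asymptotics Topology Complex

namespace BarnesBeta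

variable {f : ℂ → ℂ}

theorem RuijsenaarsClass.continuousOn (hf : RuijsenaarsClass f) :
    ContinuousOn (fun t : ℝ => f t) (Ioi 0) := by
  refine hf.differentiableOn.continuousOn.comp continuous_ofReal.continuousOn fun t ht => ?_
  simpa using ht

theorem RuijsenaarsClass.exp_mul_isBigO (hf : RuijsenaarsClass f) {w : ℂ} {c : ℝ}
    (hc : c < w.re) :
    (fun t : ℝ => exp (-w * t) * f t) =O[atTop] fun t => Real.exp (-c * t) := by
  obtain ⟨C, n, h⟩ := hf.growth
  have h1 : (fun t : ℝ => f t) =O[atTop] fun t : ℝ => t ^ n := by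
    refine IsBigO.of_bound C ?_
    filter_upwards [eventually_ge_atTop 1] with t ht
    rw [Real.norm_of_nonneg (by positivity)]
    exact h t ht
  have h2 : (fun t : ℝ => t ^ n) =O[atTop] fun t => Real.exp ((w.re - c) * t) :=
    (isLittleO_pow_exp_pos_mul_atTop n (by linarith)).isBigO
  have h3 : (fun t : ℝ => exp (-w * t)) =O[atTop] fun t => Real.exp (-w.re * t) := by
    refine IsBigO.of_bound 1 (Eventually.of_forall fun t => ?_)
    simp [norm_exp]
  refine (h3.mul (h1.trans h2)).congr_right fun t => ?_
  rw [← Real.exp_add]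
  congr 1
  ring

theorem hasTaylorDecay_exp_mul (hf : RuijsenaarsClass f) {w : ℂ} (hw : 0 < w.re) :
    ∃ a, HasTaylorDecay (fun t : ℝ => exp (-w * t) * f t) a := by
  have han : AnalyticAt ℂ (fun z : ℂ => exp (-w * z) * f z) 0 :=
    AnalyticAt.mul (by fun_prop) hf.analyticAt_zero
  obtain ⟨p, hp⟩ := han
  refine ⟨fun n => p.coeff n, ?_, ⟨w.re / 2, by linarith, hf.exp_mul_isBigO (by linarith)⟩,
    fun K => ?_⟩
  · exact (ContinuousOn.mul (by fun_prop) hf.continuousOn).locallyIntegrableOn measurableSet_Ioi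
  · have h1 := hp.isBigO_sub_partialSum_pow K
    have h2 : Tendsto (fun t : ℝ => (t : ℂ)) (𝓝[>] 0) (𝓝 0) := by
      have : Tendsto (fun t : ℝ => (t : ℂ)) (𝓝 0) (𝓝 ((0 : ℝ) : ℂ)) :=
        continuous_ofReal.tendsto 0
      simpa using this.mono_left nhdsWithin_le_nhds
    refine ((h1.comp_tendsto h2).congr_left fun t => ?_).trans
      (IsBigO.of_bound 1 (Eventually.of_forall fun t => ?_))
    · simp only [Function.comp, zero_add, FormalMultilinearSeries.partialSum]
      congr 1
      refine Finset.sum_congr rfl fun n _ => ?_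
      rw [FormalMultilinearSeries.apply_eq_pow_smul_coeff, smul_eq_mul, mul_comm]
    · simp

/-- The factor `t^(-M)` shifts the Mellin variable by `M`. -/
theorem zetaIntegral_eq_mellin (f : ℂ → ℂ) (M : ℕ) (s w : ℂ) :
    zetaIntegral f M s w = (Gamma s)⁻¹ * mellin (fun t : ℝ => exp (-w * t) * f t) (s - M) := by
  unfold zetaIntegral mellin
  congr 1
  refine setIntegral_congr_fun measurableSet_Ioi fun t ht => ?_
  have ht0 : (t : ℂ) ≠ 0 := by exact_mod_cast (ne_of_gt ht)
  simp only [smul_eq_mul]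
  rw [show s - M - 1 = (s - 1) - M by ring, cpow_sub (s - 1) _ ht0, cpow_natCast]
  ring

theorem isZetaContinuation_zeta (hf : RuijsenaarsClass f) (M : ℕ) {w : ℂ} (hw : 0 < w.re) :
    IsZetaContinuation f M w fun s => zeta f M s w := by
  obtain ⟨a, ha⟩ := hasTaylorDecay_exp_mul hf hw
  obtain ⟨Z, hZ, hZ'⟩ := ha.exists_continuation M
  have h : ∃ Z : ℂ → ℂ, IsZetaContinuation f M w Z :=
    ⟨Z, hZ, fun s hs => by rw [hZ' s hs, zetaIntegral_eq_mellin]⟩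
  have h2 : (fun s => zeta f M s w) = h.choose := by
    ext s
    simp [zeta, h]
  rw [h2]
  exact h.choose_spec

theorem isOpen_compl_poles (M : ℕ) : IsOpen {s : ℂ | ∀ k ∈ Finset.Icc 1 M, s ≠ (k : ℂ)} := by
  have : {s : ℂ | ∀ k ∈ Finset.Icc 1 M, s ≠ (k : ℂ)} =
      ⋂ k ∈ Finset.Icc 1 M, {(k : ℂ)}ᶜ := by
    ext s
    simp
  rw [this]
  exact isOpen_biInter_finset fun k _ => isOpen_compl_singleton

/-- The exponential polynomial `∑ cᵢ exp (-wᵢ t)` times `f t`. -/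
def expPolyMul {ι : Type*} (I : Finset ι) (c w : ι → ℂ) (f : ℂ → ℂ) (t : ℝ) : ℂ :=
  ∑ i ∈ I, c i * (exp (-w i * t) * f t)

section ExpPoly

variable {ι : Type*} {I : Finset ι} {c w : ι → ℂ}

theorem expPolyMul_isBigO_zero (hf : RuijsenaarsClass f) {m : ℕ}
    (h : (fun t : ℝ => ∑ i ∈ I, c i * exp (-w i * t)) =O[𝓝[>] 0] fun t : ℝ => t ^ m) :
    expPolyMul I c w f =O[𝓝[>] 0] fun t : ℝ => t ^ (-(-(m : ℝ))) := by
  have h2 : Tendsto (fun t : ℝ => f t) (𝓝[>] 0) (𝓝 (f 0)) := by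
    have h3 : ContinuousAt (fun t : ℝ => f t) 0 :=
      ContinuousAt.comp (f := fun t : ℝ => (t : ℂ)) (g := f)
        (by simpa using hf.analyticAt_zero.continuousAt) (by fun_prop)
    simpa using h3.tendsto.mono_left nhdsWithin_le_nhds
  refine (h.mul (h2.isBigO_one ℝ)).congr (fun t => ?_) fun t => by simp
  rw [expPolyMul, Finset.sum_mul]
  exact Finset.sum_congr rfl fun i _ => by ring

theorem expPolyMul_isBigO_top (hf : RuijsenaarsClass f) (hw : ∀ i ∈ I, 0 < (w i).re) :
    ∃ d > 0, expPolyMul I c w f =O[atTop] fun t => Real.exp (-d * t) := by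
  obtain ⟨d, hd, h⟩ : ∃ d > 0, ∀ i ∈ I, d < (w i).re := by
    rcases I.eq_empty_or_nonempty with rfl | hne
    · exact ⟨1, one_pos, by simp⟩
    · obtain ⟨j, hj, hmin⟩ := I.exists_min_image (fun i => (w i).re) hne
      refine ⟨(w j).re / 2, half_pos (hw j hj), fun i hi => ?_⟩
      have := hmin i hi
      have := hw j hj
      linarith
  refine ⟨d, hd, ?_⟩
  unfold expPolyMul
  exact IsBigO.fun_sum fun i hi => (hf.exp_mul_isBigO (h i hi)).const_mul_left _

theorem expPolyMul_locallyIntegrableOn (hf : RuijsenaarsClass f) :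
    LocallyIntegrableOn (expPolyMul I c w f) (Ioi 0) := by
  refine ContinuousOn.locallyIntegrableOn ?_ measurableSet_Ioi
  unfold expPolyMul
  refine continuousOn_finsetSum _ fun i _ => ?_
  exact continuousOn_const.mul (ContinuousOn.mul (by fun_prop) hf.continuousOn)

theorem mellinConvergent_expPolyMul (hf : RuijsenaarsClass f) (hw : ∀ i ∈ I, 0 < (w i).re) {m : ℕ}
    (h : (fun t : ℝ => ∑ i ∈ I, c i * exp (-w i * t)) =O[𝓝[>] 0] fun t : ℝ => t ^ m)
    {s : ℂ} (hs : -(m : ℝ) < s.re) : MellinConvergent (expPolyMul I c w f) s := by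
  obtain ⟨d, hd, hO⟩ := expPolyMul_isBigO_top (c := c) hf hw
  exact mellinConvergent_of_isBigO_rpow_exp hd (expPolyMul_locallyIntegrableOn hf) hO
    (expPolyMul_isBigO_zero hf h) hs

theorem differentiableAt_mellin_expPolyMul (hf : RuijsenaarsClass f)
    (hw : ∀ i ∈ I, 0 < (w i).re) {m : ℕ}
    (h : (fun t : ℝ => ∑ i ∈ I, c i * exp (-w i * t)) =O[𝓝[>] 0] fun t : ℝ => t ^ m)
    {s : ℂ} (hs : -(m : ℝ) < s.re) : DifferentiableAt ℂ (mellin (expPolyMul I c w f)) s := by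
  obtain ⟨d, hd, hO⟩ := expPolyMul_isBigO_top (c := c) hf hw
  exact mellin_differentiableAt_of_isBigO_rpow_exp hd (expPolyMul_locallyIntegrableOn hf) hO
    (expPolyMul_isBigO_zero hf h) hs

theorem mellin_expPolyMul (hf : RuijsenaarsClass f) (hw : ∀ i ∈ I, 0 < (w i).re) {s : ℂ}
    (hs : 0 < s.re) :
    mellin (expPolyMul I c w f) s =
      ∑ i ∈ I, c i * mellin (fun t : ℝ => exp (-w i * t) * f t) s := by
  unfold mellin expPolyMul
  simp_rw [Finset.smul_sum]
  rw [integral_finsetSum]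
  · refine Finset.sum_congr rfl fun i _ => ?_
    rw [← integral_const_mul]
    congr 1
    ext t
    simp only [smul_eq_mul]
    ring
  · intro i hi
    have h := mellinConvergent_expPolyMul (I := {i}) (c := c) (w := w) (m := 0) hf
      (by simpa using hw i hi) ?_ (s := s) (by simpa using hs)
    · simpa [MellinConvergent, expPolyMul, IntegrableOn] using h
    · simp only [Finset.sum_singleton, pow_zero]
      have : ContinuousAt (fun t : ℝ => c i * exp (-w i * t)) 0 := by fun_prop
      exact (this.tendsto.mono_left nhdsWithin_le_nhds).isBigO_one ℝ

/-- Write `1/Γ(s) = s/Γ(s + 1)` and use `Γ(1) = 1`. -/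
theorem hasDerivAt_inv_Gamma_zero : HasDerivAt (fun s : ℂ => (Gamma s)⁻¹) 1 0 := by
  have h1 : (fun s : ℂ => (Gamma s)⁻¹) = fun s => s * (Gamma (s + 1))⁻¹ := by
    ext s
    exact one_div_Gamma_eq_self_mul_one_div_Gamma_add_one s
  have h2 : DifferentiableAt ℂ (fun s : ℂ => (Gamma (s + 1))⁻¹) 0 :=
    (differentiable_one_div_Gamma.comp (differentiable_id.add_const (1 : ℂ))) 0
  rw [h1]
  simpa using (hasDerivAt_id' (0 : ℂ)).fun_mul h2.hasDerivAt

/-- Both sides agree for `Re s > M`, and the identity theorem carries this to `0`. The possible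
poles `1, …, M` are bypassed through the upper half-plane, so only convex domains are needed. -/
theorem sum_zeta_eventuallyEq (hf : RuijsenaarsClass f) (hw : ∀ i ∈ I, 0 < (w i).re) {M : ℕ}
    (h : (fun t : ℝ => ∑ i ∈ I, c i * exp (-w i * t)) =O[𝓝[>] 0] fun t : ℝ => t ^ (M + 1)) :
    (fun s => ∑ i ∈ I, c i * zeta f M s (w i)) =ᶠ[𝓝 0]
      fun s => (Gamma s)⁻¹ * mellin (expPolyMul I c w f) (s - M) := by
  set A : ℂ → ℂ := fun s => ∑ i ∈ I, c i * zeta f M s (w i) with hA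
  set D : ℂ → ℂ := fun s => (Gamma s)⁻¹ * mellin (expPolyMul I c w f) (s - M) with hD
  have dA : ∀ s : ℂ, (∀ k ∈ Finset.Icc 1 M, s ≠ (k : ℂ)) → DifferentiableAt ℂ A s := by
    intro s hs
    refine DifferentiableAt.fun_sum fun i hi => ?_
    exact (((isZetaContinuation_zeta hf M (hw i hi)).1 s hs).differentiableAt
      ((isOpen_compl_poles M).mem_nhds hs)).const_mul _
  have dD : ∀ s : ℂ, -1 < s.re → DifferentiableAt ℂ D s := by
    intro s hs
    have h1 : DifferentiableAt ℂ (mellin (expPolyMul I c w f)) (s - M) :=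
      differentiableAt_mellin_expPolyMul hf hw h (by simp; linarith)
    exact (differentiable_one_div_Gamma s).mul
      (DifferentiableAt.comp (g := mellin (expPolyMul I c w f)) s h1 (by fun_prop))
  have hAD : ∀ s : ℂ, (M : ℝ) < s.re → A s = D s := by
    intro s hs
    simp only [hA, hD]
    rw [mellin_expPolyMul hf hw (by simpa using hs), Finset.mul_sum]
    refine Finset.sum_congr rfl fun i hi => ?_
    rw [show zeta f M s (w i) = _ from (isZetaContinuation_zeta hf M (hw i hi)).2 s hs,
      zetaIntegral_eq_mellin]
    ring
  -- `V` contains no real point, meets `Re s > M` at `M + 1 + i`, and meets the unit disc at `i/2`;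
  -- the open disc itself misses every integer `k ≥ 1`.
  let V : Set ℂ := {s | -1 < s.re} ∩ {s | 0 < s.im}
  have hVo : IsOpen V :=
    (isOpen_lt continuous_const continuous_re).inter (isOpen_lt continuous_const continuous_im)
  have hVc : Convex ℝ V := (convex_halfSpace_re_gt _).inter (convex_halfSpace_im_gt _)
  have hVp : ∀ s ∈ V, ∀ k ∈ Finset.Icc 1 M, s ≠ (k : ℂ) := by
    rintro s hs k - rfl
    simpa using hs.2
  have hBp : ∀ s ∈ Metric.ball (0 : ℂ) 1, ∀ k ∈ Finset.Icc 1 M, s ≠ (k : ℂ) := by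
    rintro s hs k hk rfl
    simp at hs hk
    omega
  have hBr : ∀ s ∈ Metric.ball (0 : ℂ) 1, -1 < s.re := by
    intro s hs
    have h1 := abs_re_le_norm s
    have h2 : ‖s‖ < 1 := by simpa using hs
    exact (abs_lt.1 (h1.trans_lt h2)).1
  have hVeq : EqOn A D V := by
    refine AnalyticOnNhd.eqOn_of_preconnected_of_eventuallyEq (z₀ := (M : ℂ) + 1 + Complex.I)
      (DifferentiableOn.analyticOnNhd (fun s hs => (dA s (hVp s hs)).differentiableWithinAt) hVo)
      (DifferentiableOn.analyticOnNhd (fun s hs => (dD s hs.1).differentiableWithinAt) hVo)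
      hVc.isPreconnected ?_ ?_
    · constructor
      · simp only [mem_ofPred_eq, add_re, natCast_re, one_re, I_re]
        linarith [Nat.cast_nonneg (α := ℝ) M]
      · simp
    · have : ∀ᶠ s : ℂ in 𝓝 ((M : ℂ) + 1 + Complex.I), (M : ℝ) < s.re :=
        (isOpen_lt continuous_const continuous_re).mem_nhds (by simp)
      exact this.mono hAD
  have hBeq : EqOn A D (Metric.ball 0 1) := by
    refine AnalyticOnNhd.eqOn_of_preconnected_of_eventuallyEq (z₀ := Complex.I / 2)
      (DifferentiableOn.analyticOnNhd (fun s hs => (dA s (hBp s hs)).differentiableWithinAt)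
        Metric.isOpen_ball)
      (DifferentiableOn.analyticOnNhd (fun s hs => (dD s (hBr s hs)).differentiableWithinAt)
        Metric.isOpen_ball)
      (convex_ball _ _).isPreconnected ?_ ?_
    · simp
      norm_num
    · refine hVeq.eventuallyEq_of_mem (hVo.mem_nhds ⟨?_, ?_⟩)
      · simp
      · simp
  exact hBeq.eventuallyEq_of_mem (Metric.ball_mem_nhds _ one_pos)

/-- A linear combination of `L_M` whose exponential polynomial vanishes to order `M + 1` at `0`
is an absolutely convergent integral. -/
theorem sum_logGamma_eq_mellin (hf : RuijsenaarsClass f) (hw : ∀ i ∈ I, 0 < (w i).re) {M : ℕ}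
    (h : (fun t : ℝ => ∑ i ∈ I, c i * exp (-w i * t)) =O[𝓝[>] 0] fun t : ℝ => t ^ (M + 1)) :
    ∑ i ∈ I, c i * logGamma f M (w i) = mellin (expPolyMul I c w f) (-M) := by
  have h0 : ∀ k ∈ Finset.Icc 1 M, (0 : ℂ) ≠ (k : ℂ) := by
    intro k hk h
    simp at hk
    have : k = 0 := by exact_mod_cast h.symm
    omega
  have hd : HasDerivAt (fun s => ∑ i ∈ I, c i * zeta f M s (w i))
      (∑ i ∈ I, c i * logGamma f M (w i)) 0 := by
    refine HasDerivAt.fun_sum fun i hi => HasDerivAt.const_mul _ ?_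
    exact (((isZetaContinuation_zeta hf M (hw i hi)).1 0 h0).differentiableAt
      ((isOpen_compl_poles M).mem_nhds h0)).hasDerivAt
  have h1 : DifferentiableAt ℂ (mellin (expPolyMul I c w f)) (0 - M) :=
    differentiableAt_mellin_expPolyMul hf hw h (by simp)
  have h2 : DifferentiableAt ℂ (fun s : ℂ => mellin (expPolyMul I c w f) (s - M)) 0 :=
    DifferentiableAt.comp (g := mellin (expPolyMul I c w f)) 0 h1 (by fun_prop)
  -- In the product rule the derivative of the Mellin factor is multiplied by `1/Γ(0) = 0`, so only
  -- its value at `-M` survives.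
  have h3 := (hasDerivAt_inv_Gamma_zero.mul h2.hasDerivAt).congr_of_eventuallyEq
    (sum_zeta_eventuallyEq hf hw h)
  rw [hd.unique h3]
  simp

end ExpPoly

end BarnesBeta
end

/-! ### Compound Poisson laws and the Lévy–Khintchine formula. -/

noncomputable section
open Set Filter Topology ProbabilityTheory

namespace BarnesBeta

/-- The compound Poisson law whose Lévy measure is the finite measure `Λ`. -/
def cpLaw (Λ : Measure ℝ) : Measure ℝ :=
  Measure.sum fun n : ℕ =>
    ENNReal.ofReal (Real.exp (-Λ.real univ) / n.factorial) • convPow Λ n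

section Convolution

variable {𝕜 : Type*} [RCLike 𝕜] {φ : ℝ → 𝕜} {Λ : Measure ℝ}

instance isFiniteMeasure_convPow [IsFiniteMeasure Λ] (n : ℕ) : IsFiniteMeasure (convPow Λ n) := by
  induction n with
  | zero => exact inferInstanceAs (IsFiniteMeasure (Measure.dirac 0))
  | succ n ih => exact inferInstanceAs (IsFiniteMeasure ((convPow Λ n).conv Λ))

/-- Multiplicative functions factor over convolutions. Allowing real and complex values lets the
same lemmas serve `e^(-qx)` and its norm. -/
theorem integrable_conv_of_map_add {μ ν : Measure ℝ} [IsFiniteMeasure μ] [IsFiniteMeasure ν]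
    (hφ : Measurable φ) (hadd : ∀ x y, φ (x + y) = φ x * φ y)
    (hμ : Integrable φ μ) (hν : Integrable φ ν) : Integrable φ (μ.conv ν) := by
  rw [integrable_conv_iff hφ.aestronglyMeasurable]
  simp_rw [hadd, norm_mul, integral_const_mul]
  exact ⟨Eventually.of_forall fun x => hν.const_mul _, hμ.norm.mul_const _⟩

theorem integral_conv_of_map_add {μ ν : Measure ℝ} [IsFiniteMeasure μ] [IsFiniteMeasure ν]
    (hφ : Measurable φ) (hadd : ∀ x y, φ (x + y) = φ x * φ y)
    (hμ : Integrable φ μ) (hν : Integrable φ ν) :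
    ∫ x, φ x ∂(μ.conv ν) = (∫ x, φ x ∂μ) * ∫ x, φ x ∂ν := by
  rw [integral_conv (integrable_conv_of_map_add hφ hadd hμ hν)]
  simp_rw [hadd, integral_const_mul, integral_mul_const]

theorem integrable_convPow [IsFiniteMeasure Λ] (hφ : Measurable φ)
    (hadd : ∀ x y, φ (x + y) = φ x * φ y) (hint : Integrable φ Λ) (n : ℕ) :
    Integrable φ (convPow Λ n) := by
  induction n with
  | zero => exact integrable_dirac (by simp)
  | succ n ih => exact integrable_conv_of_map_add hφ hadd ih hint

theorem integral_convPow [IsFiniteMeasure Λ] (hφ : Measurable φ)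
    (hadd : ∀ x y, φ (x + y) = φ x * φ y) (h0 : φ 0 = 1) (hint : Integrable φ Λ) (n : ℕ) :
    ∫ x, φ x ∂convPow Λ n = (∫ x, φ x ∂Λ) ^ n := by
  induction n with
  | zero => simp [convPow, h0]
  | succ n ih =>
    rw [pow_succ, ← ih]
    exact integral_conv_of_map_add hφ hadd (integrable_convPow hφ hadd hint n) hint

theorem hasSum_exp_neg_mul_pow (r L : ℝ) :
    HasSum (fun n : ℕ => Real.exp (-r) / n.factorial * L ^ n) (Real.exp (L - r)) := by
  have h := (NormedSpace.expSeries_div_hasSum_exp L).mul_left (Real.exp (-r))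
  rw [← Real.exp_eq_exp_ℝ, ← Real.exp_add] at h
  rw [show L - r = -r + L by ring]
  exact h.congr_fun fun n => by ring

theorem integrable_cpLaw [IsFiniteMeasure Λ] (hφ : Measurable φ)
    (hadd : ∀ x y, φ (x + y) = φ x * φ y) (h0 : φ 0 = 1) (hint : Integrable φ Λ) :
    Integrable φ (cpLaw Λ) := by
  refine integrable_sum_measure
    (fun n => (integrable_convPow hφ hadd hint n).smul_measure ENNReal.ofReal_ne_top) ?_
  have h : ∀ n, ∫ x, ‖φ x‖ ∂convPow Λ n = (∫ x, ‖φ x‖ ∂Λ) ^ n :=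
    integral_convPow (φ := fun x => ‖φ x‖) hφ.norm (fun x y => by rw [hadd, norm_mul])
      (by simp [h0]) hint.norm
  simp_rw [integral_smul_measure, h, smul_eq_mul]
  refine (hasSum_exp_neg_mul_pow (Λ.real univ) (∫ x, ‖φ x‖ ∂Λ)).summable.congr fun n => ?_
  rw [ENNReal.toReal_ofReal (by positivity)]

theorem integral_cpLaw [IsFiniteMeasure Λ] {φ : ℝ → ℂ} (hφ : Measurable φ)
    (hadd : ∀ x y, φ (x + y) = φ x * φ y) (h0 : φ 0 = 1) (hint : Integrable φ Λ) :
    ∫ x, φ x ∂cpLaw Λ = Complex.exp (∫ x, (φ x - 1) ∂Λ) := by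
  have h1 := hasSum_integral_measure (integrable_cpLaw hφ hadd h0 hint)
  have h2 := (NormedSpace.expSeries_div_hasSum_exp (∫ x, φ x ∂Λ)).mul_left
    (Complex.exp (-Λ.real univ))
  rw [← Complex.exp_eq_exp_ℂ, ← Complex.exp_add] at h2
  rw [integral_sub hint (integrable_const _), integral_const, sub_eq_neg_add]
  simp only [Complex.real_smul, mul_one]
  refine h1.unique (h2.congr_fun ?_)
  intro n
  rw [integral_smul_measure, integral_convPow hφ hadd h0 hint,
    ENNReal.toReal_ofReal (by positivity), Complex.real_smul]
  push_cast
  ring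

instance isProbabilityMeasure_cpLaw [IsFiniteMeasure Λ] : IsProbabilityMeasure (cpLaw Λ) := by
  -- The multiplicative function `1` tests the total mass: its integrability gives finiteness, and
  -- its integral is `exp 0`.
  have h1 := integrable_cpLaw (Λ := Λ) (φ := fun _ => (1 : ℂ)) measurable_const (by simp) rfl
    (integrable_const _)
  have h2 := integral_cpLaw (Λ := Λ) (φ := fun _ => (1 : ℂ)) measurable_const (by simp) rfl
    (integrable_const _)
  have h3 : IsFiniteMeasure (cpLaw Λ) := by
    rcases integrable_const_iff.1 h1 with h | h
    · simp at h
    · exact h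
  simp only [integral_const, Complex.real_smul, mul_one, sub_self, mul_zero, Complex.exp_zero] at h2
  rw [isProbabilityMeasure_iff_real]
  exact_mod_cast h2

theorem convPow_Iio_zero [IsFiniteMeasure Λ] (hΛ : Λ (Iic 0) = 0) (n : ℕ) :
    convPow Λ n (Iio 0) = 0 ∧ convPow Λ (n + 1) (Iic 0) = 0 := by
  have key : ∀ n, convPow Λ n (Iio 0) = 0 → convPow Λ (n + 1) (Iic 0) = 0 := by
    intro n hn
    change ((convPow Λ n).conv Λ) (Iic 0) = 0
    rw [← lintegral_indicator_one measurableSet_Iic,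
      Measure.lintegral_conv (measurable_one.indicator measurableSet_Iic)]
    refine (lintegral_congr_ae ?_).trans lintegral_zero
    filter_upwards [measure_eq_zero_iff_ae_notMem.1 hn] with x hx
    refine (lintegral_congr_ae ?_).trans lintegral_zero
    filter_upwards [measure_eq_zero_iff_ae_notMem.1 hΛ] with y hy
    refine indicator_of_notMem (fun h => ?_) _
    simp only [mem_Iio, mem_Iic, not_lt, not_le] at hx hy h
    linarith
  have h0 : convPow Λ n (Iio 0) = 0 := by
    induction n with
    | zero => simp [convPow]
    | succ n ih => exact measure_mono_null Iio_subset_Iic_self (key n ih)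
  exact ⟨h0, key n h0⟩

theorem cpLaw_Iio_zero [IsFiniteMeasure Λ] (hΛ : Λ (Iic 0) = 0) : cpLaw Λ (Iio 0) = 0 := by
  simp [cpLaw, Measure.sum_apply _ measurableSet_Iio, (convPow_Iio_zero hΛ _).1]

theorem cpLaw_singleton_zero [IsFiniteMeasure Λ] (hΛ : Λ (Iic 0) = 0) :
    cpLaw Λ {0} = ENNReal.ofReal (Real.exp (-Λ.real univ)) := by
  rw [cpLaw, Measure.sum_apply _ (measurableSet_singleton _), tsum_eq_single 0]
  · simp [convPow]
  · intro n hn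
    obtain ⟨k, rfl⟩ := Nat.exists_eq_succ_of_ne_zero hn
    rw [Measure.smul_apply, measure_mono_null (by simp) (convPow_Iio_zero hΛ k).2, smul_zero]

/-- Every convolution power with `n ≥ 1` is absolutely continuous, so only the atom of the `n = 0`
term can charge a null set. -/
theorem cpLaw_le_of_volume_eq_zero [IsFiniteMeasure Λ] (hΛ : Λ ≪ volume) {s : Set ℝ}
    (hs : MeasurableSet s) (h0 : volume s = 0) :
    cpLaw Λ s ≤ ENNReal.ofReal (Real.exp (-Λ.real univ)) := by
  rw [cpLaw, Measure.sum_apply _ hs, tsum_eq_single 0]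
  · simp only [convPow, Nat.factorial_zero, Nat.cast_one, div_one, Measure.smul_apply,
      smul_eq_mul]
    exact mul_le_of_le_one_right' prob_le_one
  · intro n hn
    obtain ⟨k, rfl⟩ := Nat.exists_eq_succ_of_ne_zero hn
    have : (convPow Λ k).conv Λ ≪ volume := Measure.conv_absolutelyContinuous hΛ
    rw [Measure.smul_apply, show convPow Λ (k + 1) s = 0 from this h0, smul_zero]

theorem convPow_smul {ν : Measure ℝ} [IsFiniteMeasure ν] {c : ENNReal} (hc : c ≠ ⊤) (n : ℕ) :
    convPow (c • ν) n = c ^ n • convPow ν n := by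
  have : IsFiniteMeasure (c • ν) := Measure.smul_finite ν hc
  induction n with
  | zero => simp [convPow]
  | succ n ih =>
    have : SFinite (c ^ n • convPow ν n) := inferInstance
    rw [convPow, ih, Measure.conv_smul_left, Measure.conv_smul_right, smul_smul, pow_succ]
    rfl

theorem cpLaw_smul {ν : Measure ℝ} [IsProbabilityMeasure ν] {r : ℝ} (hr : 0 ≤ r) :
    cpLaw (ENNReal.ofReal r • ν) = compoundPoisson r ν := by
  have h : (ENNReal.ofReal r • ν).real univ = r := by
    simp [measureReal_def, hr]
  unfold cpLaw compoundPoisson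
  congr 1
  ext1 n
  rw [h, convPow_smul ENNReal.ofReal_ne_top, smul_smul, ← ENNReal.ofReal_pow hr,
    ← ENNReal.ofReal_mul (by positivity)]
  congr 2
  ring

end Convolution

/-- `μ` is a probability measure on `[0, ∞)` whose Laplace transform on `Re q > -β` is given by the
Lévy–Khintchine formula without drift, with Lévy measure `Λ`. -/
structure HasLevyMeasure (β : ℝ) (Λ μ : Measure ℝ) : Prop where
  isProbabilityMeasure : IsProbabilityMeasure μ
  nonneg : μ (Iio 0) = 0
  integrable : ∀ q : ℂ, -β < q.re → Integrable (fun x : ℝ => Complex.exp (-q * x)) μ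
  laplace : ∀ q : ℂ, -β < q.re →
    ∫ x : ℝ, Complex.exp (-q * x) ∂μ = Complex.exp (∫ t : ℝ, (Complex.exp (-q * t) - 1) ∂Λ)

/-- The integrability condition on a Lévy measure on `(0, ∞)`. -/
structure IsLevy (β : ℝ) (Λ : Measure ℝ) : Prop where
  pos : Λ (Iic 0) = 0
  integrable : ∀ q : ℂ, -β < q.re → Integrable (fun t : ℝ => Complex.exp (-q * t) - 1) Λ

/-- As `β > 0`, the imaginary axis lies in the domain of the Laplace transform, which is there the
characteristic function. -/
theorem HasLevyMeasure.eq {β : ℝ} (hβ : 0 < β) {Λ μ ν : Measure ℝ} (hμ : HasLevyMeasure β Λ μ)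
    (hν : HasLevyMeasure β Λ ν) : μ = ν := by
  have := hμ.isProbabilityMeasure
  have := hν.isProbabilityMeasure
  refine Measure.ext_of_charFun ?_
  ext t
  have hq : -β < (-(t * Complex.I) : ℂ).re := by simpa using hβ
  have h := (hμ.laplace _ hq).trans (hν.laplace _ hq).symm
  rw [charFun_apply_real, charFun_apply_real]
  convert h using 4 <;> ring

theorem exp_neg_mul_add (q : ℂ) (x y : ℝ) :
    Complex.exp (-q * (x + y : ℝ)) = Complex.exp (-q * x) * Complex.exp (-q * y) := by
  rw [← Complex.exp_add]
  push_cast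
  ring_nf

theorem IsLevy.mono {β : ℝ} {Λ Λ' : Measure ℝ} (h : IsLevy β Λ) (hle : Λ' ≤ Λ) : IsLevy β Λ' :=
  ⟨nonpos_iff_eq_zero.1 ((hle _).trans_eq h.pos), fun q hq => (h.integrable q hq).mono_measure hle⟩

theorem IsLevy.hasLevyMeasure_cpLaw {β : ℝ} {Λ : Measure ℝ} [IsFiniteMeasure Λ]
    (h : IsLevy β Λ) : HasLevyMeasure β Λ (cpLaw Λ) := by
  have hint : ∀ q : ℂ, -β < q.re → Integrable (fun t : ℝ => Complex.exp (-q * t)) Λ := by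
    intro q hq
    exact ((h.integrable q hq).add (integrable_const (1 : ℂ))).congr
      (Eventually.of_forall fun t => by simp)
  exact ⟨inferInstance, cpLaw_Iio_zero h.pos,
    fun q hq => integrable_cpLaw (by fun_prop) (exp_neg_mul_add q) (by simp) (hint q hq),
    fun q hq => integral_cpLaw (by fun_prop) (exp_neg_mul_add q) (by simp) (hint q hq)⟩

theorem HasLevyMeasure.conv {β : ℝ} {Λ₁ Λ₂ μ₁ μ₂ : Measure ℝ} (h₁ : HasLevyMeasure β Λ₁ μ₁)
    (h₂ : HasLevyMeasure β Λ₂ μ₂) (hL₁ : IsLevy β Λ₁) (hL₂ : IsLevy β Λ₂) :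
    HasLevyMeasure β (Λ₁ + Λ₂) (μ₁.conv μ₂) := by
  have := h₁.isProbabilityMeasure
  have := h₂.isProbabilityMeasure
  refine ⟨inferInstance, ?_, fun q hq => ?_, fun q hq => ?_⟩
  · rw [← lintegral_indicator_one measurableSet_Iio,
      Measure.lintegral_conv (measurable_one.indicator measurableSet_Iio)]
    refine (lintegral_congr_ae ?_).trans lintegral_zero
    filter_upwards [measure_eq_zero_iff_ae_notMem.1 h₁.nonneg] with x hx
    refine (lintegral_congr_ae ?_).trans lintegral_zero
    filter_upwards [measure_eq_zero_iff_ae_notMem.1 h₂.nonneg] with y hy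
    refine indicator_of_notMem (fun h => ?_) _
    simp only [mem_Iio, not_lt] at hx hy h
    linarith
  · exact integrable_conv_of_map_add (by fun_prop) (exp_neg_mul_add q) (h₁.integrable q hq)
      (h₂.integrable q hq)
  · rw [integral_conv_of_map_add (by fun_prop) (exp_neg_mul_add q) (h₁.integrable q hq)
      (h₂.integrable q hq), h₁.laplace q hq, h₂.laplace q hq, ← Complex.exp_add,
      integral_add_measure (hL₁.integrable q hq) (hL₂.integrable q hq)]

/-- Markov's inequality for `|e^(-t) - 1|`, which is at least `1 - e^(-ε)` beyond `ε`. -/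
theorem IsLevy.measure_Ioi_lt_top {β : ℝ} (hβ : 0 < β) {Λ : Measure ℝ} (h : IsLevy β Λ) {ε : ℝ}
    (hε : 0 < ε) : Λ (Ioi ε) < ⊤ := by
  have h1 := h.integrable 1 (by simp; linarith)
  have h2 : 0 < 1 - Real.exp (-ε) := by simpa using hε
  refine (measure_mono fun t (ht : ε < t) => ?_).trans_lt (h1.measure_norm_ge_lt_top h2)
  have h3 : Complex.exp (-1 * t) - 1 = ((Real.exp (-t) - 1 : ℝ) : ℂ) := by push_cast; simp
  have h4 : Real.exp (-t) ≤ Real.exp (-ε) := Real.exp_le_exp.2 (by linarith)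
  change _ ≤ ‖Complex.exp (-1 * t) - 1‖
  rw [h3, Complex.norm_real, Real.norm_eq_abs, abs_sub_comm]
  exact le_trans (by linarith) (le_abs_self _)

end BarnesBeta
end

/-! ### Existence for infinite Lévy measures, and absolute continuity. -/

noncomputable section
open Set Filter Topology ProbabilityTheory

namespace BarnesBeta

/-- The set of `t > 0` with `⌊1 / t⌋ = n`. -/
def invFloorSet (n : ℕ) : Set ℝ := {t | 0 < t ∧ ⌊1 / t⌋₊ = n}

theorem measurableSet_invFloorSet (n : ℕ) : MeasurableSet (invFloorSet n) := by
  have h : Measurable fun t : ℝ => ⌊1 / t⌋₊ := Nat.measurable_floor.comp (by fun_prop)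
  exact measurableSet_Ioi.inter (h (measurableSet_singleton n))

theorem pairwise_disjoint_invFloorSet : Pairwise (Function.onFun Disjoint invFloorSet) := by
  intro m n hmn
  refine disjoint_left.2 fun t h1 h2 => hmn (h1.2.symm.trans h2.2)

theorem iUnion_invFloorSet : ⋃ n, invFloorSet n = Ioi 0 := by
  ext t
  simp [invFloorSet]

/-- Each slice stays away from `0`, so a Lévy measure is finite on it. -/
theorem invFloorSet_subset (n : ℕ) : invFloorSet n ⊆ Ioi (1 / (n + 1 : ℝ)) := by
  rintro t ⟨h0, rfl⟩
  have h := Nat.lt_floor_add_one (1 / t)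
  rw [mem_Ioi, one_div_lt (by positivity) h0]
  exact h

section Existence

variable {β : ℝ} {Λ : Measure ℝ}

theorem IsLevy.isFiniteMeasure_restrict (hβ : 0 < β) (h : IsLevy β Λ) (n : ℕ) :
    IsFiniteMeasure (Λ.restrict (invFloorSet n)) :=
  ⟨by
    rw [Measure.restrict_apply_univ]
    exact (measure_mono (invFloorSet_subset n)).trans_lt
      (h.measure_Ioi_lt_top hβ (by positivity))⟩

theorem IsLevy.hasSum_integral (h : IsLevy β Λ) {q : ℂ} (hq : -β < q.re) :
    HasSum (fun n => ∫ t, (Complex.exp (-q * t) - 1) ∂(Λ.restrict (invFloorSet n)))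
      (∫ t, (Complex.exp (-q * t) - 1) ∂Λ) := by
  have h1 := hasSum_integral_iUnion measurableSet_invFloorSet pairwise_disjoint_invFloorSet
    (h.integrable q hq).integrableOn
  have h2 : Λ.restrict (Ioi 0) = Λ := by
    refine Measure.restrict_eq_self_of_ae_mem ?_
    filter_upwards [measure_eq_zero_iff_ae_notMem.1 h.pos] with t ht
    simpa using ht
  rwa [iUnion_invFloorSet, h2] at h1

/-- The law of the sequence of independent compound Poisson variables with Lévy measures
`Λ.restrict (invFloorSet n)`. -/
def levySeq (Λ : Measure ℝ) [∀ n, IsFiniteMeasure (Λ.restrict (invFloorSet n))] :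
    Measure (ℕ → ℝ) :=
  Measure.infinitePi fun n => cpLaw (Λ.restrict (invFloorSet n))

variable [∀ n, IsFiniteMeasure (Λ.restrict (invFloorSet n))]

instance : IsProbabilityMeasure (levySeq Λ) :=
  inferInstanceAs (IsProbabilityMeasure (Measure.infinitePi _))

theorem iIndepFun_levySeq : iIndepFun (fun (n : ℕ) (ω : ℕ → ℝ) => ω n) (levySeq Λ) :=
  iIndepFun_infinitePi (X := fun _ x => x) fun _ => measurable_id

theorem map_eval_levySeq (n : ℕ) :
    (levySeq Λ).map (fun ω => ω n) = cpLaw (Λ.restrict (invFloorSet n)) :=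
  Measure.infinitePi_map_eval _ n

theorem IsLevy.ae_levySeq_nonneg (h : IsLevy β Λ) : ∀ᵐ ω ∂levySeq Λ, ∀ n, 0 ≤ ω n := by
  refine ae_all_iff.2 fun n => ?_
  have h1 := (h.mono (Measure.restrict_le_self (s := invFloorSet n))).hasLevyMeasure_cpLaw.nonneg
  rw [← map_eval_levySeq, Measure.map_apply (measurable_pi_apply n) measurableSet_Iio] at h1
  filter_upwards [measure_eq_zero_iff_ae_notMem.1 h1] with ω hω
  simpa using hω

theorem IsLevy.integral_levySeq (h : IsLevy β Λ) {q : ℂ} (hq : -β < q.re) (n : ℕ) :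
    ∫ ω, Complex.exp (-q * (∑ k ∈ Finset.range n, ω k : ℝ)) ∂levySeq Λ =
      Complex.exp (∑ k ∈ Finset.range n,
        ∫ t, (Complex.exp (-q * t) - 1) ∂(Λ.restrict (invFloorSet k))) := by
  have h1 : iIndepFun (fun (k : Fin n) (ω : ℕ → ℝ) => ω k) (levySeq Λ) :=
    iIndepFun_levySeq.precomp Fin.val_injective
  have h2 := h1.integral_fun_prod_comp (f := fun _ x => Complex.exp (-q * ((x : ℝ) : ℂ)))
    (fun k : Fin n => (measurable_pi_apply (k : ℕ)).aemeasurable)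
    (fun k => Measurable.aestronglyMeasurable (by fun_prop))
  have h3 : ∀ k : ℕ, ∫ ω, Complex.exp (-q * ((ω k : ℝ) : ℂ)) ∂levySeq Λ =
      Complex.exp (∫ t, (Complex.exp (-q * t) - 1) ∂(Λ.restrict (invFloorSet k))) := by
    intro k
    rw [← (h.mono (Measure.restrict_le_self (s := invFloorSet k))).hasLevyMeasure_cpLaw.laplace q hq,
      ← map_eval_levySeq, integral_map (measurable_pi_apply k).aemeasurable
      (Measurable.aestronglyMeasurable (by fun_prop))]
  simp_rw [h3] at h2
  rw [← Finset.prod_range (fun k => Complex.exp (∫ t, (Complex.exp (-q * t) - 1)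
    ∂(Λ.restrict (invFloorSet k)))), ← Complex.exp_sum] at h2
  rw [← h2]
  congr 1
  ext ω
  rw [← Finset.prod_range (fun k => Complex.exp (-q * ((ω k : ℝ) : ℂ))), ← Complex.exp_sum,
    ← Finset.mul_sum]
  push_cast
  rfl

theorem IsLevy.integrable_exp_levySeq (h : IsLevy β Λ) {a : ℝ} (ha : a < β) (n : ℕ) :
    Integrable (fun ω => Real.exp (a * ∑ k ∈ Finset.range n, ω k)) (levySeq Λ) := by
  have h1 := (iIndepFun_levySeq (Λ := Λ)).integrable_exp_mul_sum measurable_pi_apply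
    (s := Finset.range n) (t := a) fun k _ => ?_
  · simpa using h1
  · have h2 := ((h.mono (Measure.restrict_le_self
      (s := invFloorSet k))).hasLevyMeasure_cpLaw.integrable (-a) (by simpa using ha)).norm
    rw [← map_eval_levySeq] at h2
    refine (h2.comp_aemeasurable (measurable_pi_apply k).aemeasurable).congr (Eventually.of_forall fun ω => ?_)
    simp [Complex.norm_exp]

/-- A bound uniform in `n`: for `a ≥ 0` the slice exponents are nonnegative, so their partial sums
stay below the integral over all of `Λ`. -/
theorem IsLevy.lintegral_exp_levySeq_le (h : IsLevy β Λ) {a : ℝ} (ha0 : 0 ≤ a) (ha : a < β)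
    (n : ℕ) :
    ∫⁻ ω, ENNReal.ofReal (Real.exp (a * ∑ k ∈ Finset.range n, ω k)) ∂levySeq Λ ≤
      ENNReal.ofReal (Real.exp (∫ t, (Real.exp (a * t) - 1) ∂Λ)) := by
  rw [← ofReal_integral_eq_lintegral_ofReal (h.integrable_exp_levySeq ha n)
    (Eventually.of_forall fun ω => (Real.exp_pos _).le)]
  refine ENNReal.ofReal_le_ofReal ?_
  have hq : -β < (-a : ℂ).re := by simpa using ha
  have h1 := h.integral_levySeq hq n
  have h2 : ∀ μ : Measure ℝ, ∫ t, (Complex.exp (-(-a : ℂ) * t) - 1) ∂μ =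
      ((∫ t, (Real.exp (a * t) - 1) ∂μ : ℝ) : ℂ) := by
    intro μ
    rw [← integral_complex_ofReal]
    simp
  simp_rw [h2] at h1
  have h3 : ∫ ω, Complex.exp (-(-a : ℂ) * (∑ k ∈ Finset.range n, ω k : ℝ)) ∂levySeq Λ =
      ((∫ ω, Real.exp (a * ∑ k ∈ Finset.range n, ω k) ∂levySeq Λ : ℝ) : ℂ) := by
    rw [← integral_complex_ofReal]
    simp
  rw [h3] at h1
  have h4 := h.hasSum_integral hq
  simp_rw [h2] at h4
  have h5 : ∫ ω, Real.exp (a * ∑ k ∈ Finset.range n, ω k) ∂levySeq Λ =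
      Real.exp (∑ k ∈ Finset.range n,
        ∫ t, (Real.exp (a * t) - 1) ∂(Λ.restrict (invFloorSet k))) := by
    exact_mod_cast h1
  rw [h5]
  refine Real.exp_le_exp.2 (sum_le_hasSum _ (fun k _ => ?_) (Complex.hasSum_ofReal.1 h4))
  refine integral_nonneg_of_ae ?_
  filter_upwards [ae_restrict_mem (measurableSet_invFloorSet k)] with t ht
  have := Real.one_le_exp (mul_nonneg ha0 ht.1.le)
  simpa using this

theorem IsLevy.lintegral_iSup_exp_levySeq_lt_top (h : IsLevy β Λ) {a : ℝ} (ha0 : 0 ≤ a)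
    (ha : a < β) :
    ∫⁻ ω, ⨆ n : ℕ, ENNReal.ofReal (Real.exp (a * ∑ k ∈ Finset.range n, ω k)) ∂levySeq Λ < ⊤ := by
  rw [lintegral_iSup' (fun n => Measurable.aemeasurable (by fun_prop))]
  · exact (iSup_le (h.lintegral_exp_levySeq_le ha0 ha)).trans_lt ENNReal.ofReal_lt_top
  · filter_upwards [h.ae_levySeq_nonneg] with ω hω
    refine monotone_nat_of_le_succ fun n => ENNReal.ofReal_le_ofReal (Real.exp_le_exp.2 ?_)
    rw [Finset.sum_range_succ]
    exact mul_le_mul_of_nonneg_left (by linarith [hω n]) ha0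

/-- Taking `a = β/2`, the supremum of the exponentials of the partial sums has finite mean, hence is
finite almost surely; by `x + 1 ≤ e^x` it bounds the partial sums. -/
theorem IsLevy.ae_summable_levySeq (hβ : 0 < β) (h : IsLevy β Λ) :
    ∀ᵐ ω ∂levySeq Λ, Summable ω := by
  have h1 := h.lintegral_iSup_exp_levySeq_lt_top (half_pos hβ).le (half_lt_self hβ)
  have h2 := ae_lt_top (Measurable.iSup fun n => by fun_prop) h1.ne
  filter_upwards [h2, h.ae_levySeq_nonneg] with ω hω hpos
  refine summable_of_sum_range_le
    (c := (⨆ n : ℕ, ENNReal.ofReal (Real.exp (β / 2 * ∑ k ∈ Finset.range n, ω k))).toReal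
      / (β / 2)) hpos fun n => ?_
  rw [le_div_iff₀' (half_pos hβ)]
  have h3 := (ENNReal.ofReal_le_iff_le_toReal hω.ne).1
    (le_iSup (fun n : ℕ => ENNReal.ofReal (Real.exp (β / 2 * ∑ k ∈ Finset.range n, ω k))) n)
  linarith [Real.add_one_le_exp (β / 2 * ∑ k ∈ Finset.range n, ω k)]

theorem aemeasurable_tsum_levySeq (hβ : 0 < β) (h : IsLevy β Λ) :
    AEMeasurable (fun ω : ℕ → ℝ => ∑' n, ω n) (levySeq Λ) := by
  refine aemeasurable_of_tendsto_metrizable_ae atTop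
    (f := fun n ω => ∑ k ∈ Finset.range n, ω k)
    (fun n => Measurable.aemeasurable (by fun_prop)) ?_
  filter_upwards [h.ae_summable_levySeq hβ] with ω hω
  exact hω.hasSum.tendsto_sum_nat

theorem IsLevy.integrable_exp_tsum (hβ : 0 < β) (h : IsLevy β Λ) {a : ℝ} (ha0 : 0 ≤ a)
    (ha : a < β) : Integrable (fun ω : ℕ → ℝ => Real.exp (a * ∑' n, ω n)) (levySeq Λ) := by
  refine ⟨(Real.measurable_exp.comp_aemeasurable
    ((aemeasurable_tsum_levySeq hβ h).const_mul a)).aestronglyMeasurable, ?_⟩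
  refine lt_of_le_of_lt (lintegral_mono_ae ?_) (h.lintegral_iSup_exp_levySeq_lt_top ha0 ha)
  filter_upwards [h.ae_summable_levySeq hβ] with ω hω
  rw [Real.enorm_eq_ofReal (Real.exp_pos _).le]
  have h1 : Tendsto (fun n : ℕ => ENNReal.ofReal (Real.exp (a * ∑ k ∈ Finset.range n, ω k))) atTop
      (𝓝 (ENNReal.ofReal (Real.exp (a * ∑' n, ω n)))) :=
    ENNReal.tendsto_ofReal ((Real.continuous_exp.tendsto _).comp
      (hω.hasSum.tendsto_sum_nat.const_mul a))
  exact le_of_tendsto' h1 fun n =>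
    le_iSup (fun n : ℕ => ENNReal.ofReal (Real.exp (a * ∑ k ∈ Finset.range n, ω k))) n

/-- The positive part of `-Re q` handles both signs at once; when `Re q > -β` it lies in `[0, β)`,
where the dominating function is integrable. -/
theorem IsLevy.norm_exp_le (h : IsLevy β Λ) (q : ℂ) :
    ∀ᵐ ω ∂levySeq Λ, Summable ω → ∀ n, ‖Complex.exp (-q * (∑ k ∈ Finset.range n, ω k : ℝ))‖ ≤
      Real.exp (max (-q.re) 0 * ∑' k, ω k) := by
  filter_upwards [h.ae_levySeq_nonneg] with ω hpos hs n
  have h0 : 0 ≤ ∑ k ∈ Finset.range n, ω k := Finset.sum_nonneg fun k _ => hpos k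
  have h1 : ∑ k ∈ Finset.range n, ω k ≤ ∑' k, ω k := hs.sum_le_tsum _ fun k _ => hpos k
  rw [Complex.norm_exp, Real.exp_le_exp, Complex.re_mul_ofReal, Complex.neg_re]
  calc -q.re * ∑ k ∈ Finset.range n, ω k
      ≤ max (-q.re) 0 * ∑ k ∈ Finset.range n, ω k := by gcongr; exact le_max_left _ _
    _ ≤ _ := mul_le_mul_of_nonneg_left h1 (le_max_right _ _)

theorem IsLevy.hasLevyMeasure_tsum (hβ : 0 < β) (h : IsLevy β Λ) :
    HasLevyMeasure β Λ ((levySeq Λ).map fun ω => ∑' n, ω n) := by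
  have hm := aemeasurable_tsum_levySeq hβ h
  have hlim : ∀ q : ℂ, ∀ᵐ ω ∂levySeq Λ,
      Tendsto (fun n : ℕ => Complex.exp (-q * (∑ k ∈ Finset.range n, ω k : ℝ))) atTop
        (𝓝 (Complex.exp (-q * (∑' k, ω k : ℝ)))) := by
    intro q
    filter_upwards [h.ae_summable_levySeq hβ] with ω hω
    exact ((by fun_prop : Continuous fun x : ℝ => Complex.exp (-q * x)).tendsto _).comp
      hω.hasSum.tendsto_sum_nat
  have hdom : ∀ q : ℂ, -β < q.re →
      Integrable (fun ω : ℕ → ℝ => Real.exp (max (-q.re) 0 * ∑' k, ω k)) (levySeq Λ) :=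
    fun q hq => h.integrable_exp_tsum hβ (le_max_right _ _) (max_lt (by linarith) hβ)
  have hle : ∀ q : ℂ, ∀ᵐ ω ∂levySeq Λ, ∀ n,
      ‖Complex.exp (-q * (∑ k ∈ Finset.range n, ω k : ℝ))‖ ≤
        Real.exp (max (-q.re) 0 * ∑' k, ω k) := by
    intro q
    filter_upwards [h.norm_exp_le q, h.ae_summable_levySeq hβ] with ω h1 h2
    exact h1 h2
  refine ⟨Measure.isProbabilityMeasure_map hm, ?_, fun q hq => ?_, fun q hq => ?_⟩
  · rw [Measure.map_apply_of_aemeasurable hm measurableSet_Iio, measure_eq_zero_iff_ae_notMem]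
    filter_upwards [h.ae_levySeq_nonneg] with ω hω
    simpa using tsum_nonneg hω
  · rw [integrable_map_measure (Measurable.aestronglyMeasurable (by fun_prop)) hm]
    refine (hdom q hq).mono' ((by fun_prop : Measurable fun x : ℝ =>
      Complex.exp (-q * x)).comp_aemeasurable hm).aestronglyMeasurable ?_
    filter_upwards [hlim q, hle q] with ω h1 h2
    exact le_of_tendsto' h1.norm h2
  · rw [integral_map hm (Measurable.aestronglyMeasurable (by fun_prop))]
    have h1 := tendsto_integral_of_dominated_convergence _
      (fun n => Measurable.aestronglyMeasurable (by fun_prop)) (hdom q hq)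
      (fun n => (hle q).mono fun ω hω => hω n) (hlim q)
    simp_rw [h.integral_levySeq hq] at h1
    exact tendsto_nhds_unique h1
      ((Complex.continuous_exp.tendsto _).comp (h.hasSum_integral hq).tendsto_sum_nat)

end Existence

theorem IsLevy.exists_hasLevyMeasure {β : ℝ} (hβ : 0 < β) {Λ : Measure ℝ} (h : IsLevy β Λ) :
    ∃ μ, HasLevyMeasure β Λ μ := by
  have := h.isFiniteMeasure_restrict hβ
  exact ⟨_, h.hasLevyMeasure_tsum hβ⟩

/-- By uniqueness `μ` is the law of the small jumps convolved with the compound Poisson law of the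
jumps above `ε`. Given the small jumps, the second factor sees a translate of `s`, which is again
null. -/
theorem HasLevyMeasure.le_exp {β : ℝ} (hβ : 0 < β) {Λ μ : Measure ℝ} (hΛ : IsLevy β Λ)
    (hμ : HasLevyMeasure β Λ μ) (hac : Λ ≪ volume) {s : Set ℝ} (hs : MeasurableSet s)
    (h0 : volume s = 0) {ε : ℝ} (hε : 0 < ε) :
    μ s ≤ ENNReal.ofReal (Real.exp (-(Λ (Ioi ε)).toReal)) := by
  have : IsFiniteMeasure (Λ.restrict (Ioi ε)) :=
    ⟨by rw [Measure.restrict_apply_univ]; exact hΛ.measure_Ioi_lt_top hβ hε⟩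
  have hΛ₁ : IsLevy β (Λ.restrict (Ioi ε)) := hΛ.mono Measure.restrict_le_self
  have hΛ₂ : IsLevy β (Λ.restrict (Iic ε)) := hΛ.mono Measure.restrict_le_self
  obtain ⟨ν, hν⟩ := hΛ₂.exists_hasLevyMeasure hβ
  have := hν.isProbabilityMeasure
  have h1 := hν.conv hΛ₁.hasLevyMeasure_cpLaw hΛ₂ hΛ₁
  have h2 : Λ.restrict (Iic ε) + Λ.restrict (Ioi ε) = Λ := by
    rw [← compl_Iic]
    exact Measure.restrict_add_restrict_compl measurableSet_Iic
  rw [h2] at h1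
  rw [hμ.eq hβ h1, ← lintegral_indicator_one hs,
    Measure.lintegral_conv (measurable_one.indicator hs)]
  calc ∫⁻ x, ∫⁻ y, s.indicator 1 (x + y) ∂cpLaw (Λ.restrict (Ioi ε)) ∂ν
      ≤ ∫⁻ _, ENNReal.ofReal (Real.exp (-(Λ (Ioi ε)).toReal)) ∂ν := by
        refine lintegral_mono fun x => ?_
        have hs' : MeasurableSet ((fun y => x + y) ⁻¹' s) := hs.preimage (by fun_prop)
        have h3 := cpLaw_le_of_volume_eq_zero (Λ := Λ.restrict (Ioi ε))
          (Measure.restrict_le_self.absolutelyContinuous.trans hac) hs'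
          (by rwa [measure_preimage_add])
        rw [measureReal_def, Measure.restrict_apply_univ] at h3
        refine le_trans (le_of_eq ?_) h3
        rw [← lintegral_indicator_one hs']
        rfl
    _ = _ := by simp

/-- Tucker's theorem: an infinitely divisible law with an infinite, absolutely continuous Lévy
measure is absolutely continuous. -/
theorem HasLevyMeasure.absolutelyContinuous {β : ℝ} (hβ : 0 < β) {Λ μ : Measure ℝ}
    (hΛ : IsLevy β Λ) (hμ : HasLevyMeasure β Λ μ) (hac : Λ ≪ volume) (htop : Λ univ = ⊤) :
    μ ≪ volume := by
  refine Measure.AbsolutelyContinuous.mk fun s hs h0 => ?_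
  have hmono : Monotone fun n : ℕ => Ioi (1 / ((n : ℝ) + 1)) := fun m n hmn =>
    Ioi_subset_Ioi (one_div_le_one_div_of_le (by positivity) (by gcongr))
  have hU : Λ (⋃ n : ℕ, Ioi (1 / ((n : ℝ) + 1))) = ⊤ := by
    have h1 : (⋃ n : ℕ, Ioi (1 / ((n : ℝ) + 1))) = Ioi 0 := by
      ext t
      simp only [mem_iUnion, mem_Ioi]
      exact ⟨fun ⟨n, hn⟩ => lt_trans (by positivity) hn, exists_nat_one_div_lt⟩
    have h2 : Λ univ ≤ Λ (Ioi 0) + Λ (Iic 0) :=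
      (measure_mono (by simp)).trans (measure_union_le _ _)
    rw [hΛ.pos, add_zero, htop] at h2
    rw [h1]
    exact top_le_iff.1 h2
  -- Along `ε = 1/(n + 1)` the masses `Λ(ε,∞)` increase to `∞`, so the bound of
  -- `HasLevyMeasure.le_exp` tends to `0`.
  have h1 := tendsto_measure_iUnion_atTop (μ := Λ) hmono
  rw [hU] at h1
  have h2 : Tendsto (fun n : ℕ => (Λ (Ioi (1 / ((n : ℝ) + 1)))).toReal) atTop atTop := by
    refine tendsto_atTop.2 fun R => ?_
    filter_upwards [h1.eventually (lt_mem_nhds (ENNReal.ofReal_lt_top (r := R)))] with n hn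
    exact (ENNReal.ofReal_le_iff_le_toReal
      (hΛ.measure_Ioi_lt_top hβ (by positivity)).ne).1 hn.le
  have h3 : Tendsto (fun n : ℕ =>
      ENNReal.ofReal (Real.exp (-(Λ (Ioi (1 / ((n : ℝ) + 1)))).toReal))) atTop (𝓝 0) := by
    rw [← ENNReal.ofReal_zero]
    exact ENNReal.tendsto_ofReal (Real.tendsto_exp_neg_atTop_nhds_zero.comp h2)
  exact nonpos_iff_eq_zero.1 (ge_of_tendsto' h3 fun n =>
    hμ.le_exp hβ hΛ hac hs h0 (by positivity))

end BarnesBeta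
end

/-! ### The Lévy measure attached to `f`, and the formula for `η`. -/

noncomputable section
open Set Filter Topology Asymptotics

namespace BarnesBeta

theorem altSum_eq_sum_powerset (N : ℕ) (b : ℕ → ℝ) (g : ℂ → ℂ) (q : ℂ) :
    altSum N b g q = ∑ K ∈ (Finset.Icc 1 N).powerset,
      (-1 : ℂ) ^ K.card * g (q + b 0 + ∑ k ∈ K, (b k : ℂ)) := by
  rw [Finset.sum_powerset, altSum, Nat.card_Icc, Nat.add_sub_cancel]
  refine Finset.sum_congr rfl fun p _ => ?_
  rw [Finset.mul_sum]
  refine Finset.sum_congr rfl fun K hK => ?_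
  rw [(Finset.mem_powersetCard.1 hK).2]

/-- The exponential polynomial `e^(-b₀ t) ∏_{j=1}^N (1 - e^(-b_j t))`. -/
def levyExp (N : ℕ) (b : ℕ → ℝ) (t : ℝ) : ℂ :=
  Complex.exp (-b 0 * t) * ∏ j ∈ Finset.Icc 1 N, (1 - Complex.exp (-b j * t))

theorem sum_powerset_exp (N : ℕ) (b : ℕ → ℝ) (q : ℂ) (t : ℝ) :
    ∑ K ∈ (Finset.Icc 1 N).powerset,
      (-1 : ℂ) ^ K.card * Complex.exp (-(q + b 0 + ∑ k ∈ K, (b k : ℂ)) * t) =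
      Complex.exp (-q * t) * levyExp N b t := by
  have h := Finset.prod_add (fun j : ℕ => -Complex.exp (-b j * t)) (fun _ => 1) (Finset.Icc 1 N)
  simp only [Finset.prod_const_one, mul_one, Finset.prod_neg, neg_add_eq_sub] at h
  rw [levyExp, h, Finset.mul_sum, Finset.mul_sum]
  refine Finset.sum_congr rfl fun K _ => ?_
  rw [← Complex.exp_sum, ← Finset.sum_mul, Finset.sum_neg_distrib,
    show -(q + b 0 + ∑ k ∈ K, (b k : ℂ)) * t =
      -q * t + (-b 0 * t + (-∑ k ∈ K, (b k : ℂ)) * t) by ring, Complex.exp_add, Complex.exp_add]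
  ring

theorem isBigO_exp_sub_one (q : ℂ) :
    (fun t : ℝ => Complex.exp (-q * t) - 1) =O[𝓝[>] 0] fun t : ℝ => t := by
  have h : DifferentiableAt ℝ (fun t : ℝ => Complex.exp (-q * t)) 0 := by
    have h1 : DifferentiableAt ℝ (fun t : ℝ => (t : ℂ)) 0 :=
      Complex.ofRealCLM.differentiableAt
    fun_prop
  simpa using h.isBigO_sub.mono nhdsWithin_le_nhds

/-- Each of the `N` factors `1 - e^(-b_j t)` has a zero at `0`. -/
theorem levyExp_isBigO (N : ℕ) (b : ℕ → ℝ) :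
    levyExp N b =O[𝓝[>] 0] fun t : ℝ => t ^ N := by
  have h1 : (fun t : ℝ => Complex.exp (-b 0 * t)) =O[𝓝[>] 0] fun _ : ℝ => (1 : ℝ) := by
    have : ContinuousAt (fun t : ℝ => Complex.exp (-b 0 * t)) 0 := by fun_prop
    exact (this.tendsto.mono_left nhdsWithin_le_nhds).isBigO_one ℝ
  have h2 : ∀ s : Finset ℕ, (fun t : ℝ => ∏ j ∈ s, (1 - Complex.exp (-b j * t)))
      =O[𝓝[>] 0] fun t : ℝ => t ^ s.card := by
    intro s
    induction s using Finset.cons_induction with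
    | empty => simpa using Asymptotics.isBigO_const_const (1 : ℂ) (one_ne_zero (α := ℝ)) (𝓝[>] (0 : ℝ))
    | cons j s hj ih =>
      simp only [Finset.prod_cons, Finset.card_cons]
      refine (((isBigO_exp_sub_one (b j)).neg_left.mul ih).congr_left fun t => ?_).congr_right
        fun t => ?_
      · rw [neg_sub]
      · ring
  refine (h1.mul (h2 (Finset.Icc 1 N))).congr_right fun t => ?_
  rw [one_mul, Nat.card_Icc, Nat.add_sub_cancel]

section Density

variable {f : ℂ → ℂ} {b : ℕ → ℝ} {M N : ℕ}

theorem levyDensity_pos (hpos : PositiveOnHalfLine f) (hb : ∀ k, 0 < b k) {t : ℝ} (ht : 0 < t) :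
    0 < levyDensity f M N b t := by
  have h1 := (hpos t ht.le).2
  have h2 : 0 < ∏ j ∈ Finset.Icc 1 N, (1 - Real.exp (-b j * t)) := by
    refine Finset.prod_pos fun j _ => ?_
    have := mul_pos (hb j) ht
    rw [sub_pos, Real.exp_lt_one_iff]
    linarith
  unfold levyDensity
  positivity

theorem cpow_smul_levyExp (hpos : PositiveOnHalfLine f) {t : ℝ} (ht : 0 < t) :
    (t : ℂ) ^ ((-M : ℂ) - 1) * (levyExp N b t * f t) = (levyDensity f M N b t : ℂ) := by
  have hf : f t = ((f t).re : ℂ) := Complex.ext rfl (by simpa using (hpos t ht.le).1)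
  have ht0 : (t : ℂ) ≠ 0 := by exact_mod_cast ht.ne'
  rw [show (-M : ℂ) - 1 = -((M + 1 : ℕ) : ℂ) by push_cast; ring, Complex.cpow_neg,
    Complex.cpow_natCast, hf, levyExp, levyDensity]
  push_cast
  field_simp

theorem aemeasurable_levyDensity (hf : RuijsenaarsClass f) :
    AEMeasurable (levyDensity f M N b) (volume.restrict (Ioi 0)) := by
  refine ContinuousOn.aemeasurable ?_ measurableSet_Ioi
  unfold levyDensity
  refine ContinuousOn.div (ContinuousOn.mul (by fun_prop)
    (Complex.continuous_re.comp_continuousOn hf.continuousOn)) (by fun_prop) fun t ht => ?_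
  exact pow_ne_zero _ (ne_of_gt ht)

theorem integrable_levyMeasure_iff (hf : RuijsenaarsClass f) (hpos : PositiveOnHalfLine f)
    (hb : ∀ k, 0 < b k) {g : ℝ → ℂ} :
    Integrable g (levyMeasure f M N b) ↔
      IntegrableOn (fun t => levyDensity f M N b t • g t) (Ioi 0) := by
  rw [levyMeasure, integrable_withDensity_iff_integrable_smul₀'
    (aemeasurable_levyDensity hf).ennreal_ofReal (by simp), IntegrableOn]
  refine integrable_congr ?_
  filter_upwards [ae_restrict_mem measurableSet_Ioi] with t ht
  rw [ENNReal.toReal_ofReal (levyDensity_pos hpos hb ht).le]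

theorem integral_levyMeasure (hf : RuijsenaarsClass f) (hpos : PositiveOnHalfLine f)
    (hb : ∀ k, 0 < b k) (g : ℝ → ℂ) :
    ∫ t, g t ∂levyMeasure f M N b = ∫ t in Ioi 0, levyDensity f M N b t • g t := by
  rw [levyMeasure, integral_withDensity_eq_integral_toReal_smul₀
    (aemeasurable_levyDensity hf).ennreal_ofReal (by simp)]
  refine setIntegral_congr_fun measurableSet_Ioi fun t ht => ?_
  rw [ENNReal.toReal_ofReal (levyDensity_pos hpos hb ht).le]

theorem levyMeasure_Iic_zero : levyMeasure f M N b (Iic 0) = 0 := by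
  refine withDensity_absolutelyContinuous _ _ ?_
  rw [Measure.restrict_apply measurableSet_Iic, Iic_inter_Ioi, Ioc_self, measure_empty]

theorem levyMeasure_absolutelyContinuous : levyMeasure f M N b ≪ volume :=
  (withDensity_absolutelyContinuous _ _).trans Measure.restrict_le_self.absolutelyContinuous

/-- The index set for `(𝒮_N g)(q | b) - (𝒮_N g)(0 | b)`. -/
def diffIndex (N : ℕ) : Finset (Finset ℕ × Bool) := (Finset.Icc 1 N).powerset ×ˢ Finset.univ

/-- The coefficients of `(𝒮_N g)(q | b) - (𝒮_N g)(0 | b)`. -/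
def diffCoeff (i : Finset ℕ × Bool) : ℂ := if i.2 then (-1) ^ i.1.card else -(-1) ^ i.1.card

/-- The arguments of `g` in `(𝒮_N g)(q | b) - (𝒮_N g)(0 | b)`. -/
def diffArg (b : ℕ → ℝ) (q : ℂ) (i : Finset ℕ × Bool) : ℂ :=
  (if i.2 then q else 0) + b 0 + ∑ k ∈ i.1, (b k : ℂ)

theorem diffArg_re_pos (hb : ∀ k, 0 < b k) {q : ℂ} (hq : -b 0 < q.re) (i : Finset ℕ × Bool) :
    0 < (diffArg b q i).re := by
  have h1 : 0 ≤ ∑ k ∈ i.1, b k := Finset.sum_nonneg fun k _ => (hb k).le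
  have h2 := hb 0
  rcases i with ⟨K, _ | _⟩ <;> simp [diffArg] <;> simp at h1 <;> linarith

theorem sum_diffIndex (q : ℂ) (g : ℂ → ℂ) :
    ∑ i ∈ diffIndex N, diffCoeff i * g (diffArg b q i) = altSum N b g q - altSum N b g 0 := by
  rw [diffIndex, Finset.sum_product, altSum_eq_sum_powerset, altSum_eq_sum_powerset,
    ← Finset.sum_sub_distrib]
  refine Finset.sum_congr rfl fun K _ => ?_
  simp only [Fintype.sum_bool, diffCoeff, diffArg, if_true, Bool.false_eq_true, if_false]
  ring

theorem sum_diffIndex_exp (q : ℂ) (t : ℝ) :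
    ∑ i ∈ diffIndex N, diffCoeff i * Complex.exp (-diffArg b q i * t) =
      (Complex.exp (-q * t) - 1) * levyExp N b t := by
  rw [sum_diffIndex (g := fun w => Complex.exp (-w * t)), altSum_eq_sum_powerset,
    altSum_eq_sum_powerset, sum_powerset_exp, sum_powerset_exp]
  simp
  ring

theorem expPolyMul_diff (q : ℂ) (t : ℝ) :
    expPolyMul (diffIndex N) diffCoeff (diffArg b q) f t =
      (Complex.exp (-q * t) - 1) * levyExp N b t * f t := by
  rw [← sum_diffIndex_exp, expPolyMul, Finset.sum_mul]
  exact Finset.sum_congr rfl fun i _ => by ring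

/-- The factor `e^(-qt) - 1` supplies the extra order that is needed when `M = N`. -/
theorem diff_isBigO (hMN : M ≤ N) (b : ℕ → ℝ) (q : ℂ) :
    (fun t : ℝ => ∑ i ∈ diffIndex N, diffCoeff i * Complex.exp (-diffArg b q i * t))
      =O[𝓝[>] 0] fun t : ℝ => t ^ (M + 1) := by
  simp_rw [sum_diffIndex_exp]
  refine ((isBigO_exp_sub_one q).mul (levyExp_isBigO N b)).trans ?_
  refine IsBigO.of_bound 1 ?_
  filter_upwards [Ioc_mem_nhdsGT (zero_lt_one' ℝ)] with t ht
  rw [← pow_succ', one_mul, Real.norm_of_nonneg (pow_nonneg ht.1.le _),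
    Real.norm_of_nonneg (pow_nonneg ht.1.le _)]
  exact pow_le_pow_of_le_one ht.1.le ht.2 (by omega)

/-- The function to be integrated, times the density, is the Mellin integrand at `s = -M`, whose
convergence is already known. -/
theorem isLevy_levyMeasure (hf : RuijsenaarsClass f) (hpos : PositiveOnHalfLine f)
    (hb : ∀ k, 0 < b k) (hMN : M ≤ N) : IsLevy (b 0) (levyMeasure f M N b) := by
  refine ⟨levyMeasure_Iic_zero, fun q hq => ?_⟩
  rw [integrable_levyMeasure_iff hf hpos hb]
  have h := mellinConvergent_expPolyMul hf (fun i _ => diffArg_re_pos hb hq i)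
    (diff_isBigO hMN b q) (s := -M) (by simp)
  refine IntegrableOn.congr_fun h (fun t ht => ?_) measurableSet_Ioi
  simp only [smul_eq_mul, expPolyMul_diff, Complex.real_smul]
  rw [← cpow_smul_levyExp hpos ht]
  ring

theorem eta_eq (hf : RuijsenaarsClass f) (hpos : PositiveOnHalfLine f)
    (hb : ∀ k, 0 < b k) (hMN : M ≤ N) {q : ℂ} (hq : -b 0 < q.re) :
    eta f M N b q =
      Complex.exp (∫ t, (Complex.exp (-q * t) - 1) ∂levyMeasure f M N b) := by
  rw [eta, ← sum_diffIndex, sum_logGamma_eq_mellin hf (fun i _ => diffArg_re_pos hb hq i)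
    (diff_isBigO hMN b q), integral_levyMeasure hf hpos hb, mellin]
  congr 1
  refine setIntegral_congr_fun measurableSet_Ioi fun t ht => ?_
  simp only [smul_eq_mul, expPolyMul_diff, Complex.real_smul]
  rw [← cpow_smul_levyExp hpos ht]
  ring

/-- When `M < N`, the order `N` of `levyExp` alone makes the Mellin integral at `-M` converge. -/
theorem integrableOn_levyDensity (hf : RuijsenaarsClass f) (hpos : PositiveOnHalfLine f)
    (hb : ∀ k, 0 < b k) (hMN : M < N) : IntegrableOn (levyDensity f M N b) (Ioi 0) := by
  have hsum : ∀ t : ℝ, ∑ K ∈ (Finset.Icc 1 N).powerset,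
      (-1 : ℂ) ^ K.card * Complex.exp (-((b 0 : ℂ) + ∑ k ∈ K, (b k : ℂ)) * t) =
      levyExp N b t := by
    intro t
    simpa using sum_powerset_exp N b 0 t
  have h := mellinConvergent_expPolyMul (I := (Finset.Icc 1 N).powerset)
    (c := fun K => (-1 : ℂ) ^ K.card) (w := fun K => (b 0 : ℂ) + ∑ k ∈ K, (b k : ℂ)) (m := N) hf
    (fun K _ => ?_) ?_ (s := -M) (by simpa using hMN)
  · have h1 : IntegrableOn (fun t => (levyDensity f M N b t : ℂ)) (Ioi 0) := by
      refine IntegrableOn.congr_fun h (fun t ht => ?_) measurableSet_Ioi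
      simp only [smul_eq_mul]
      rw [← cpow_smul_levyExp hpos ht, ← hsum, expPolyMul, Finset.sum_mul]
      congr 1
      exact Finset.sum_congr rfl fun i _ => by ring
    exact h1.re
  · have h1 : 0 ≤ ∑ k ∈ K, b k := Finset.sum_nonneg fun k _ => (hb k).le
    have h2 := hb 0
    simp only [Complex.add_re, Complex.ofReal_re, Complex.re_sum]
    linarith
  · simp_rw [hsum]
    exact levyExp_isBigO N b

theorem levyMeasure_univ (hf : RuijsenaarsClass f) (hpos : PositiveOnHalfLine f)
    (hb : ∀ k, 0 < b k) (hMN : M < N) :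
    levyMeasure f M N b univ = ENNReal.ofReal (∫ t in Ioi 0, levyDensity f M N b t) := by
  rw [levyMeasure, withDensity_apply _ MeasurableSet.univ, Measure.restrict_univ,
    ofReal_integral_eq_lintegral_ofReal (integrableOn_levyDensity hf hpos hb hMN)]
  filter_upwards [ae_restrict_mem measurableSet_Ioi] with t ht
  exact (levyDensity_pos hpos hb ht).le

theorem integral_levyDensity_pos (hf : RuijsenaarsClass f) (hpos : PositiveOnHalfLine f)
    (hb : ∀ k, 0 < b k) (hMN : M < N) : 0 < ∫ t in Ioi 0, levyDensity f M N b t := by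
  rw [setIntegral_pos_iff_support_of_nonneg_ae _ (integrableOn_levyDensity hf hpos hb hMN)]
  · have : Ioi (0 : ℝ) ⊆ Function.support (levyDensity f M N b) := fun t ht =>
      (levyDensity_pos hpos hb ht).ne'
    rw [inter_eq_right.2 this]
    simp
  · filter_upwards [ae_restrict_mem measurableSet_Ioi] with t ht
    exact (levyDensity_pos hpos hb ht).le

theorem tendsto_mul_levyDensity (hf : RuijsenaarsClass f) :
    Tendsto (fun t => t * levyDensity f N N b t) (𝓝[>] 0)
      (𝓝 ((∏ j ∈ Finset.Icc 1 N, b j) * (f 0).re)) := by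
  have h1 : ∀ c : ℝ, Tendsto (fun t : ℝ => (1 - Real.exp (-c * t)) / t) (𝓝[>] 0) (𝓝 c) := by
    intro c
    have h : HasDerivAt (fun t : ℝ => 1 - Real.exp (-c * t)) c 0 := by
      simpa using (((hasDerivAt_id' (0 : ℝ)).const_mul (-c)).exp).const_sub 1
    refine h.tendsto_slope_zero_right.congr fun t => ?_
    simp
    ring
  have h2 : Tendsto (fun t : ℝ => (f t).re) (𝓝[>] 0) (𝓝 (f 0).re) := by
    have h3 : ContinuousAt (fun t : ℝ => f t) 0 :=
      ContinuousAt.comp (f := fun t : ℝ => (t : ℂ)) (g := f)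
        (by simpa using hf.analyticAt_zero.continuousAt) (by fun_prop)
    have h4 := (Complex.continuous_re.continuousAt.comp h3).tendsto.mono_left
      (nhdsWithin_le_nhds (s := Ioi 0))
    simpa [Function.comp_def] using h4
  have h3 : Tendsto (fun t : ℝ => Real.exp (-b 0 * t)) (𝓝[>] 0) (𝓝 1) := by
    have : ContinuousAt (fun t : ℝ => Real.exp (-b 0 * t)) 0 := by fun_prop
    simpa using this.tendsto.mono_left (nhdsWithin_le_nhds (s := Ioi 0))
  have h4 := (h3.mul (tendsto_finsetProd (Finset.Icc 1 N) fun j _ => h1 (b j))).mul h2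
  rw [one_mul] at h4
  refine h4.congr' ?_
  filter_upwards [self_mem_nhdsWithin] with t ht
  have ht0 : t ≠ 0 := ne_of_gt ht
  rw [Finset.prod_div_distrib, Finset.prod_const, Nat.card_Icc, Nat.add_sub_cancel, levyDensity]
  field_simp
  ring

/-- Near `0` the density exceeds `c/(2t)` with `c = f(0) ∏ b_j > 0`, and `1/t` is not integrable
there. -/
theorem levyMeasure_univ_eq_top (hf : RuijsenaarsClass f) (hpos : PositiveOnHalfLine f)
    (hb : ∀ k, 0 < b k) : levyMeasure f N N b univ = ⊤ := by
  by_contra hne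
  have hint : IntegrableOn (levyDensity f N N b) (Ioi 0) := by
    refine ⟨(aemeasurable_levyDensity hf).aestronglyMeasurable, ?_⟩
    rw [levyMeasure, withDensity_apply _ MeasurableSet.univ, Measure.restrict_univ] at hne
    refine lt_of_le_of_lt (le_of_eq ?_) (lt_top_iff_ne_top.2 hne)
    refine setLIntegral_congr_fun measurableSet_Ioi fun t ht => ?_
    exact Real.enorm_eq_ofReal (levyDensity_pos hpos hb ht).le
  set c := (∏ j ∈ Finset.Icc 1 N, b j) * (f 0).re with hc
  have hc0 : 0 < c := mul_pos (Finset.prod_pos fun j _ => hb j) (by simpa using (hpos 0 le_rfl).2)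
  have hev := (tendsto_mul_levyDensity (N := N) (b := b) hf).eventually
    (lt_mem_nhds (half_lt_self hc0))
  obtain ⟨δ, hδ, hδ'⟩ := mem_nhdsGT_iff_exists_Ioc_subset.1 hev
  have hinv : IntegrableOn (fun t : ℝ => t⁻¹) (Ioc 0 δ) := by
    refine Integrable.mono' ((hint.mono_set Ioc_subset_Ioi_self).const_mul (2 / c))
      measurable_inv.aestronglyMeasurable ?_
    filter_upwards [ae_restrict_mem measurableSet_Ioc] with t ht
    have h1 : c / 2 < t * levyDensity f N N b t := hδ' ht
    rw [Real.norm_of_nonneg (inv_nonneg.2 ht.1.le), inv_le_iff_one_le_mul₀ ht.1]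
    calc (1 : ℝ) = 2 / c * (c / 2) := by field_simp
      _ ≤ 2 / c * (t * levyDensity f N N b t) := by gcongr
      _ = _ := by ring
  have h0 : 0 < δ := hδ
  have h1 := (intervalIntegrable_iff_integrableOn_Ioc_of_le h0.le).2 hinv
  rw [intervalIntegrable_inv_iff] at h1
  rcases h1 with h1 | h1
  · exact h0.ne h1
  · exact h1 left_mem_uIcc

end Density

end BarnesBeta
end

/-! ### Transfer between `[0, ∞)` and `(0, 1]`, and the conclusions. -/

noncomputable section
open Set Filter Topology

namespace BarnesBeta

section Main

variable {f : ℂ → ℂ} {b : ℕ → ℝ} {M N : ℕ} {μ : Measure ℝ}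

theorem ofReal_exp_neg_cpow (q : ℂ) (x : ℝ) :
    ((Real.exp (-x) : ℝ) : ℂ) ^ q = Complex.exp (-q * x) := by
  rw [Complex.cpow_def_of_ne_zero (by exact_mod_cast (Real.exp_pos _).ne'), ← Complex.ofReal_log
    (Real.exp_pos _).le, Real.log_exp]
  push_cast
  ring_nf

theorem HasLevyMeasure.isBarnesBeta (hf : RuijsenaarsClass f) (hpos : PositiveOnHalfLine f)
    (hb : ∀ k, 0 < b k) (hMN : M ≤ N) (h : HasLevyMeasure (b 0) (levyMeasure f M N b) μ) :
    IsBarnesBeta f M N b (μ.map fun x => Real.exp (-x)) := by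
  have := h.isProbabilityMeasure
  have hm : Measurable fun x : ℝ => Real.exp (-x) := by fun_prop
  have hq : ∀ q : ℂ, Measurable fun x : ℝ => (x : ℂ) ^ q := fun q =>
    Complex.measurable_ofReal.pow_const q
  refine ⟨Measure.isProbabilityMeasure_map hm.aemeasurable, ?_, fun q hq' => ?_, fun q hq' => ?_⟩
  · rw [Measure.map_apply hm measurableSet_Ioc.compl]
    refine measure_mono_null (fun x hx => ?_) h.nonneg
    simp only [mem_preimage, mem_compl_iff, mem_Ioc, not_and, not_le] at hx
    have := hx (Real.exp_pos _)
    rw [Real.one_lt_exp_iff] at this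
    simpa using this
  · rw [integrable_map_measure (hq q).aestronglyMeasurable hm.aemeasurable]
    refine (h.integrable q hq').congr (Eventually.of_forall fun x => ?_)
    exact (ofReal_exp_neg_cpow q x).symm
  · rw [integral_map hm.aemeasurable (hq q).aestronglyMeasurable, eta_eq hf hpos hb hMN hq',
      ← h.laplace q hq']
    simp_rw [ofReal_exp_neg_cpow]

theorem IsBarnesBeta.ae_mem (h : IsBarnesBeta f M N b μ) : ∀ᵐ x ∂μ, x ∈ Ioc (0 : ℝ) 1 := by
  filter_upwards [measure_eq_zero_iff_ae_notMem.1 h.support] with x hx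
  simpa using hx

theorem IsBarnesBeta.ae_cpow_eq (h : IsBarnesBeta f M N b μ) (q : ℂ) :
    ∀ᵐ x ∂μ, Complex.exp (-q * (-Real.log x : ℝ)) = (x : ℂ) ^ q := by
  filter_upwards [h.ae_mem] with x hx
  rw [← ofReal_exp_neg_cpow, neg_neg, Real.exp_log hx.1]

theorem measurable_neg_log : Measurable fun x => -Real.log x := Real.measurable_log.neg

theorem IsBarnesBeta.hasLevyMeasure (hf : RuijsenaarsClass f) (hpos : PositiveOnHalfLine f)
    (hb : ∀ k, 0 < b k) (hMN : M ≤ N) (h : IsBarnesBeta f M N b μ) :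
    HasLevyMeasure (b 0) (levyMeasure f M N b) (μ.map fun x => -Real.log x) := by
  have := h.isProbabilityMeasure
  have hm := measurable_neg_log.aemeasurable (μ := μ)
  refine ⟨Measure.isProbabilityMeasure_map hm, ?_, fun q hq => ?_, fun q hq => ?_⟩
  · rw [Measure.map_apply measurable_neg_log measurableSet_Iio, measure_eq_zero_iff_ae_notMem]
    filter_upwards [h.ae_mem] with x hx
    simpa using Real.log_nonpos hx.1.le hx.2
  · rw [integrable_map_measure (Measurable.aestronglyMeasurable (by fun_prop)) hm]
    exact (h.integrable q hq).congr ((h.ae_cpow_eq q).mono fun x hx => hx.symm)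
  · rw [integral_map hm (Measurable.aestronglyMeasurable (by fun_prop)),
      integral_congr_ae (h.ae_cpow_eq q), h.mellin q hq, eta_eq hf hpos hb hMN hq]

/-- A law on `(0, 1]` is recovered from that of `-log`, so uniqueness transfers from `[0, ∞)`. -/
theorem IsBarnesBeta.map_map (h : IsBarnesBeta f M N b μ) :
    (μ.map fun x => -Real.log x).map (fun x => Real.exp (-x)) = μ := by
  rw [Measure.map_map (by fun_prop) measurable_neg_log]
  conv_rhs => rw [← Measure.map_id (μ := μ)]
  refine Measure.map_congr ?_
  filter_upwards [h.ae_mem] with x hx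
  simp [Real.exp_log hx.1]

theorem existsUnique_isBarnesBeta (hf : RuijsenaarsClass f) (hpos : PositiveOnHalfLine f)
    (hb : ∀ k, 0 < b k) (hMN : M ≤ N) : ∃! μ, IsBarnesBeta f M N b μ := by
  obtain ⟨μ, hμ⟩ := (isLevy_levyMeasure hf hpos hb hMN).exists_hasLevyMeasure (hb 0)
  refine ⟨_, hμ.isBarnesBeta hf hpos hb hMN, fun ν hν => ?_⟩
  rw [← hν.map_map, (hν.hasLevyMeasure hf hpos hb hMN).eq (hb 0) hμ]

theorem isBarnesBeta_barnesBeta (hf : RuijsenaarsClass f) (hpos : PositiveOnHalfLine f)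
    (hb : ∀ k, 0 < b k) (hMN : M ≤ N) : IsBarnesBeta f M N b (barnesBeta f M N b) := by
  have h := (existsUnique_isBarnesBeta hf hpos hb hMN).exists
  rw [barnesBeta, dif_pos h]
  exact h.choose_spec

theorem IsBarnesBeta.map_log_absolutelyContinuous (hf : RuijsenaarsClass f)
    (hpos : PositiveOnHalfLine f) (hb : ∀ k, 0 < b k) (h : IsBarnesBeta f N N b μ) :
    μ.map Real.log ≪ volume := by
  have h1 := (h.hasLevyMeasure hf hpos hb le_rfl).absolutelyContinuous (hb 0)
    (isLevy_levyMeasure hf hpos hb le_rfl) levyMeasure_absolutelyContinuous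
    (levyMeasure_univ_eq_top hf hpos hb)
  -- Reflection preserves Lebesgue measure, so the sign of the logarithm is immaterial.
  have h2 := h1.map (f := fun x : ℝ => -x) measurable_neg
  rw [Measure.map_map measurable_neg measurable_neg_log, Measure.map_neg_eq_self] at h2
  simpa [Function.comp_def] using h2

theorem IsBarnesBeta.map_neg_log_eq_cpLaw (hf : RuijsenaarsClass f) (hpos : PositiveOnHalfLine f)
    (hb : ∀ k, 0 < b k) (hMN : M ≤ N) [IsFiniteMeasure (levyMeasure f M N b)]
    (h : IsBarnesBeta f M N b μ) :
    (μ.map fun x => -Real.log x) = cpLaw (levyMeasure f M N b) :=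
  (h.hasLevyMeasure hf hpos hb hMN).eq (hb 0)
    (isLevy_levyMeasure hf hpos hb hMN).hasLevyMeasure_cpLaw

theorem isFiniteMeasure_levyMeasure (hf : RuijsenaarsClass f) (hpos : PositiveOnHalfLine f)
    (hb : ∀ k, 0 < b k) (hMN : M < N) : IsFiniteMeasure (levyMeasure f M N b) :=
  ⟨by rw [levyMeasure_univ hf hpos hb hMN]; exact ENNReal.ofReal_lt_top⟩

/-- A nonzero finite measure on `(0, ∞)` is the Lévy measure of its compound Poisson law. -/
theorem isCompoundPoisson_cpLaw {Λ : Measure ℝ} [IsFiniteMeasure Λ] (h0 : Λ (Iic 0) = 0)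
    (hne : Λ univ ≠ 0) : IsCompoundPoisson (cpLaw Λ) Λ := by
  have hr : 0 < Λ.real univ := ENNReal.toReal_pos hne (measure_ne_top _ _)
  have hof : ENNReal.ofReal (Λ.real univ) = Λ univ := ENNReal.ofReal_toReal (measure_ne_top _ _)
  have hν : IsProbabilityMeasure ((Λ univ)⁻¹ • Λ) :=
    ⟨by rw [Measure.smul_apply, smul_eq_mul, ENNReal.inv_mul_cancel hne (measure_ne_top _ _)]⟩
  have hΛ : Λ = ENNReal.ofReal (Λ.real univ) • ((Λ univ)⁻¹ • Λ) := by
    rw [hof, smul_smul, ENNReal.mul_inv_cancel hne (measure_ne_top _ _), one_smul]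
  refine ⟨Λ.real univ, (Λ univ)⁻¹ • Λ, hr, hν, by simp [h0], ?_, hΛ⟩
  rw [← cpLaw_smul hr.le, ← hΛ]

theorem IsBarnesBeta.real_singleton_one (hf : RuijsenaarsClass f) (hpos : PositiveOnHalfLine f)
    (hb : ∀ k, 0 < b k) (hMN : M < N) (h : IsBarnesBeta f M N b μ) :
    μ.real {1} = Real.exp (-∫ t in Ioi (0 : ℝ), levyDensity f M N b t) := by
  have := isFiniteMeasure_levyMeasure hf hpos hb hMN
  have h1 : μ {1} = (μ.map fun x => -Real.log x) {0} := by
    rw [Measure.map_apply measurable_neg_log (measurableSet_singleton 0)]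
    -- The two sets agree only almost everywhere: `Real.log` also vanishes at `0` and `-1`, which
    -- the support `(0, 1]` excludes.
    refine measure_congr ?_
    filter_upwards [h.ae_mem] with x hx
    refine propext ⟨fun hx1 => ?_, fun hx0 => ?_⟩
    · rw [show x = 1 from hx1]
      change -Real.log 1 = 0
      simp
    · exact Real.eq_one_of_pos_of_log_eq_zero hx.1 (neg_eq_zero.1 hx0)
  rw [measureReal_def, h1, h.map_neg_log_eq_cpLaw hf hpos hb hMN.le,
    cpLaw_singleton_zero levyMeasure_Iic_zero, ENNReal.toReal_ofReal (Real.exp_pos _).le,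
    measureReal_def, levyMeasure_univ hf hpos hb hMN,
    ENNReal.toReal_ofReal (integral_levyDensity_pos hf hpos hb hMN).le]

end Main

end BarnesBeta
end

theorem mainTheorem2 (f : ℂ → ℂ) (hf : BarnesBeta.RuijsenaarsClass f)
    (hpos : BarnesBeta.PositiveOnHalfLine f) (b : ℕ → ℝ) (hb : ∀ k, 0 < b k)
    (M N : ℕ) (hMN : M ≤ N) :
    (∃! μ : MeasureTheory.Measure ℝ, BarnesBeta.IsBarnesBeta f M N b μ) ∧
    (M = N → MeasureTheory.Measure.AbsolutelyContinuous
      ((BarnesBeta.barnesBeta f M N b).map Real.log) MeasureTheory.volume) ∧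
    (M < N →
      BarnesBeta.IsCompoundPoisson
        ((BarnesBeta.barnesBeta f M N b).map fun x => -Real.log x)
        (BarnesBeta.levyMeasure f M N b) ∧
      MeasureTheory.IntegrableOn (BarnesBeta.levyDensity f M N b) (Set.Ioi 0) ∧
      (BarnesBeta.barnesBeta f M N b).real {1} =
        Real.exp (-∫ t in Set.Ioi (0 : ℝ), BarnesBeta.levyDensity f M N b t)) := by
  have hβ := BarnesBeta.isBarnesBeta_barnesBeta hf hpos hb hMN
  refine ⟨BarnesBeta.existsUnique_isBarnesBeta hf hpos hb hMN, ?_, fun hlt => ⟨?_, ?_, ?_⟩⟩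
  · rintro rfl
    exact hβ.map_log_absolutelyContinuous hf hpos hb
  · have := BarnesBeta.isFiniteMeasure_levyMeasure hf hpos hb hlt
    rw [hβ.map_neg_log_eq_cpLaw hf hpos hb hMN]
    -- The rate is the total mass of `Λ`, nonzero because its density is positive.
    refine BarnesBeta.isCompoundPoisson_cpLaw BarnesBeta.levyMeasure_Iic_zero ?_
    rw [BarnesBeta.levyMeasure_univ hf hpos hb hlt]
    simpa using BarnesBeta.integral_levyDensity_pos hf hpos hb hlt
  · exact BarnesBeta.integrableOn_levyDensity hf hpos hb hlt
  · exact hβ.real_singleton_one hf hpos hb hlt
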